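/- Let $H$ be a complex Hilbert space, and let $(T_0,\mathcal D(T_0))$ be a self-adjoint operator on $H$ with compact resolvent that is negative, i.e. $\langle T_0x,x\rangle\le 0$ for all $x\in\mathcal D(T_0)$. Let $T_1$ be a linear operator in $H$ with $\mathcal D(T_0)\subset\mathcal D(T_1)$, and suppose that there is a continuous function $C:(0,\infty)\to\mathbb R$ such that, for every $\delta>0$, $$\|T_1x\|\le\delta\|T_0x\|+C(\delta)\|x\|\qquad\text{for all }x\in\mathcal D(T_0).$$ For $\kappa\in\mathbb R$ put $T(\kappa)=\kappa T_0+T_1$, with domain $\mathcal D(T_0)$. Then for every $x_0\in H\setminus\{0\}$ there are constants $\kappa_0,\eta_0,C,T>0$, depending only on $x_0/\|x_0\|$, $T_0$ and $T_1$, such that the following holds. For every real $\kappa$ with $|1-\kappa|\le\kappa_0$ the operator $T(\kappa)$ generates a strongly continuous semigroup $(e^{T(\kappa)t})_{t\ge0}$ on $H$, and if $$\liminf_{t\to\infty}\frac1t\log\|e^{T(1)t}x_0\|=p\qquad\text{for some real } p>0,$$ then for all real $\kappa$ with $|1-\kappa|\le\kappa_0$ and all $x\in H$ with $\|x-x_0\|\le\eta_0\|x_0\|$,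 $$\|e^{T(\kappa)t}x\|\ge C\,e^{\frac p2t}\,\|x\|\qquad\text{for all }t\ge T.$$ -/

import Mathlib

open Filter Topology

noncomputable section

namespace OperatorSemigroup

variable {H : Type*} [NormedAddCommGroup H] [InnerProductSpace ℂ H]

/-- `R` is the resolvent `(z - T)⁻¹` of the (unbounded) operator `T` at the point `z`: a bounded,
everywhere defined, two-sided inverse of `z - T : D(T) → H`. -/
def IsResolventAt (T : H →ₗ.[ℂ] H) (z : ℂ) (R : H →L[ℂ] H) : Prop :=
  (∀ y : H, ∃ h : R y ∈ T.domain, z • R y - T ⟨R y, h⟩ = y) ∧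
    ∀ x : T.domain, R (z • (x : H) - T x) = x

/-- `T` has compact resolvent: its resolvent is a compact operator at some point of the
resolvent set (equivalently, at every point, the resolvent set being nonempty). -/
def HasCompactResolvent (T : H →ₗ.[ℂ] H) : Prop :=
  ∃ (z : ℂ) (R : H →L[ℂ] H), IsResolventAt T z R ∧ IsCompactOperator R

/-- `T` is negative: `⟨T x, x⟩ ≤ 0` on `D(T)` (the real part is the whole inner product when `T`
is symmetric). The value `0` is allowed, as for the Laplacian on a torus. -/
def IsNegative (T : H →ₗ.[ℂ] H) : Prop :=
  ∀ x : T.domain, (inner ℂ (T x) (x : H)).re ≤ 0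

/-- `T₁` is defined on `D(T₀)` and is `T₀`-bounded with arbitrarily small relative bound `δ`, the
second constant `C δ` being a continuous function of `δ > 0`. -/
def IsInfinitesimallyBounded (T₀ T₁ : H →ₗ.[ℂ] H) : Prop :=
  T₀.domain ≤ T₁.domain ∧
    ∃ C : ℝ → ℝ, ContinuousOn C (Set.Ioi 0) ∧
      ∀ δ : ℝ, 0 < δ → ∀ (x : H) (h₀ : x ∈ T₀.domain) (h₁ : x ∈ T₁.domain),
        ‖T₁ ⟨x, h₁⟩‖ ≤ δ * ‖T₀ ⟨x, h₀⟩‖ + C δ * ‖x‖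

/-- The family `T(κ) = κ T₀ + T₁` for real `κ`, with domain `D(T₀) ∩ D(T₁)`. -/
def family (T₀ T₁ : H →ₗ.[ℂ] H) (κ : ℝ) : H →ₗ.[ℂ] H :=
  (κ : ℂ) • T₀ + T₁

/-- A strongly continuous semigroup of bounded operators (only the times `t ≥ 0` matter). -/
structure IsC0Semigroup (S : ℝ → H →L[ℂ] H) : Prop where
  zero : S 0 = ContinuousLinearMap.id ℂ H
  add : ∀ s t : ℝ, 0 ≤ s → 0 ≤ t → S (s + t) = (S s).comp (S t)
  tendsto : ∀ x : H, Tendsto (fun t : ℝ => S t x) (𝓝[>] 0) (𝓝 x)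

/-- `T` is the infinitesimal generator of `S`: the pair `(x, y)` lies in the graph of `T` exactly
when `(S t x - x) / t → y` as `t ↓ 0`. In particular `D(T)` is the set of all `x` for which the
limit exists. -/
def IsGenerator (T : H →ₗ.[ℂ] H) (S : ℝ → H →L[ℂ] H) : Prop :=
  ∀ x y : H, (x, y) ∈ T.graph ↔
    Tendsto (fun t : ℝ => ((t⁻¹ : ℝ) : ℂ) • (S t x - x)) (𝓝[>] 0) (𝓝 y)

/-- `T` generates a strongly continuous semigroup. -/
def Generates (T : H →ₗ.[ℂ] H) : Prop :=
  ∃ S : ℝ → H →L[ℂ] H, IsC0Semigroup S ∧ IsGenerator T S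

open Classical in
/-- The semigroup `e^{T t}`, `t ≥ 0`, generated by `T` (a generator determines its semigroup on
`t ≥ 0`); the junk value `0` is used when `T` does not generate one. -/
def expSemigroup (T : H →ₗ.[ℂ] H) : ℝ → H →L[ℂ] H :=
  if h : Generates T then h.choose else 0

/-- The exponential growth rate `liminf_{t → ∞} (1 / t) log ‖e^{T t} x‖`, as an extended real. -/
def growthRate (T : H →ₗ.[ℂ] H) (x : H) : EReal :=
  liminf (fun t : ℝ => ((1 / t * Real.log ‖expSemigroup T t x‖ : ℝ) : EReal)) atTop

end OperatorSemigroup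

end

/-! Since $T_0$ is self-adjoint and negative, $\|zx-\kappa
T_0x\|^2\ge|z|^2\|x\|^2+\kappa^2\|T_0x\|^2$ for $\mathrm{Re}\,z\ge0$. The infinitesimal bound on
$T_1$ makes $T_1(z-\kappa T_0)^{-1}$ a contraction far to the right, so for all $\kappa\ge1/2$ the
operator $T(\kappa)$ has a compact resolvent on one common half-plane, of size $O(1/|z|)$, with
$R_\kappa-R_1=O(|1-\kappa|/|z|)$ (`exists_halfPlaneResolvent_family`).

The semigroup is recovered by inverse Laplace transform. The integral of $e^{zt}R(z)$ need not
converge absolutely, but $R'=-R^2$ and integration by parts turn it into $\frac1t$ times the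
integral of $e^{zt}R(z)^2$, which does. From this formula come generation, the bound
$\|e^{T(\kappa)t}-e^{T(1)t}\|=O(|1-\kappa|)$ at each fixed $t>0$, and compactness of $e^{T(1)t}$. As
`expSemigroup` is a chosen semigroup, uniqueness is proved to identify it with this integral.

Growth then becomes a question about the compact operator $A=e^{T(1)}$. Its nonzero spectrum is
discrete, so some annulus with radii $r<s$ between $e^{p/2}$ and $e^{3p/4}$ misses it, and the Riesz
projection $q$ splits $H$ into a part where $A^n$ is at most $Kr^n$ and a part where it expands by
at least $s^n/K$ (`exists_spectral_projection`). An orbit growing at rate $p$ has a nonzero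
component in the second part, and after a fixed time that component dominates. The cone where it
dominates is preserved and expanded by nearby operators (`cone_expansion`), so nearby data under
nearby $\kappa$ enter the cone and keep growing at rate at least $p/2$ (`exists_uniform_growth`).
Only finitely many fixed times of the semigroup enter the smallness conditions, hence the uniformity
in $t$. -/

noncomputable section

/-! ### Inverse Laplace transform of a pseudo-resolvent -/

namespace OperatorSemigroup

open MeasureTheory Complex

/-- The point `c + i s` of the vertical line of abscissa `c`. -/
def vline (c s : ℝ) : ℂ := c + s * I

@[simp] lemma vline_re (c s : ℝ) : (vline c s).re = c := by simp [vline]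

lemma norm_vline_sq (c s : ℝ) : ‖vline c s‖ ^ 2 = c ^ 2 + s ^ 2 := by
  rw [← Complex.normSq_eq_norm_sq, Complex.normSq_apply]; simp [vline]; ring

lemma le_norm_vline (c s : ℝ) : c ≤ ‖vline c s‖ := by
  simpa using Complex.re_le_norm (vline c s)

lemma hasDerivAt_vline_left (c s : ℝ) : HasDerivAt (fun x : ℝ => vline x s) 1 c := by
  simpa [vline] using (Complex.ofRealCLM.hasDerivAt (x := c)).add_const (s * I)

lemma hasDerivAt_vline_right (c s : ℝ) : HasDerivAt (fun x : ℝ => vline c x) I s := by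
  simpa [vline] using ((Complex.ofRealCLM.hasDerivAt (x := s)).mul_const I).const_add (c : ℂ)

lemma continuous_vline (c : ℝ) : Continuous (vline c) := by
  unfold vline; fun_prop

lemma integrable_inv_sq_add_sq {c : ℝ} (hc : 0 < c) :
    Integrable (fun s : ℝ => (c ^ 2 + s ^ 2)⁻¹) := by
  have h := (integrable_inv_one_add_sq.comp_div hc.ne').const_mul ((c ^ 2)⁻¹)
  refine h.congr (ae_of_all _ fun s => ?_)
  simp only []
  field_simp

lemma integral_inv_sq_add_sq {c : ℝ} (hc : 0 < c) :
    ∫ s : ℝ, (c ^ 2 + s ^ 2)⁻¹ = Real.pi / c := by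
  have h : ∀ s : ℝ, (c ^ 2 + s ^ 2)⁻¹ = (c ^ 2)⁻¹ * (1 + (s / c) ^ 2)⁻¹ := by
    intro s; field_simp
  simp_rw [h]
  rw [integral_const_mul, Measure.integral_comp_div (fun x : ℝ => (1 + x ^ 2)⁻¹),
    integral_univ_inv_one_add_sq, abs_of_pos hc, smul_eq_mul]
  field_simp

lemma norm_cexp_vline (t c s : ℝ) : ‖cexp (t * vline c s)‖ = Real.exp (t * c) := by
  rw [Complex.norm_exp]; simp [vline]

variable {A : Type*} [NormedRing A] [NormedAlgebra ℂ A]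

/-- A pseudo-resolvent on the half-plane `ω < Re z` that decays like `1 / |z|`. -/
structure IsHalfPlaneResolvent (R : ℂ → A) (ω M : ℝ) : Prop where
  pos : 0 < ω
  sub_eq : ∀ z w : ℂ, ω < z.re → ω < w.re → R z - R w = (w - z) • (R z * R w)
  norm_le : ∀ z : ℂ, ω < z.re → ‖R z‖ ≤ M / ‖z‖

/-- The integral of `e^{z t} R(z)^k` along the vertical line of abscissa `c`. -/
def laplaceInt (R : ℂ → A) (k : ℕ) (c t : ℝ) : A :=
  ∫ s : ℝ, cexp (t * vline c s) • R (vline c s) ^ k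

/-- The semigroup with resolvent `R`, as an inverse Laplace transform. -/
def laplaceSemigroup (R : ℂ → A) (ω : ℝ) (t : ℝ) : A :=
  if t ≤ 0 then 1 else ((2 * Real.pi * t : ℝ) : ℂ)⁻¹ • laplaceInt R 2 (ω + 1 / t) t

namespace IsHalfPlaneResolvent

variable {R : ℂ → A} {ω M : ℝ}

section basic

variable (h : IsHalfPlaneResolvent R ω M)
include h

lemma norm_pos {z : ℂ} (hz : ω < z.re) : 0 < ‖z‖ :=
  (h.pos.trans hz).trans_le (Complex.re_le_norm z)

lemma M_nonneg : 0 ≤ M := by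
  have hz : ω < ((ω + 1 : ℝ) : ℂ).re := by simp
  have h1 := (norm_nonneg _).trans (h.norm_le _ hz)
  have h2 := h.norm_pos hz
  by_contra hM
  exact absurd h1 (not_le.2 (div_neg_of_neg_of_pos (not_le.1 hM) h2))

lemma norm_le_div {z : ℂ} (hz : ω < z.re) : ‖R z‖ ≤ M / ω :=
  (h.norm_le z hz).trans (div_le_div_of_nonneg_left h.M_nonneg h.pos
    (hz.le.trans (Complex.re_le_norm z)))

lemma norm_pow_le {z : ℂ} (hz : ω < z.re) (k : ℕ) (hk : 0 < k) :
    ‖R z ^ k‖ ≤ M ^ k / ‖z‖ ^ k := by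
  rw [← div_pow]
  exact (norm_pow_le' _ hk).trans (pow_le_pow_left₀ (norm_nonneg _) (h.norm_le z hz) k)

lemma comm {z w : ℂ} (hz : ω < z.re) (hw : ω < w.re) : R z * R w = R w * R z := by
  rcases eq_or_ne z w with rfl | hne
  · rfl
  have h1 := h.sub_eq z w hz hw
  have h2 := h.sub_eq w z hw hz
  have h3 : (w - z) • (R z * R w - R w * R z) = 0 := by
    rw [smul_sub, ← h1]
    have : (w - z) • (R w * R z) = -(R w - R z) := by rw [h2, ← neg_smul]; congr 1; ring
    rw [this]; abel
  have := (smul_eq_zero.1 h3).resolve_left (sub_ne_zero.2 hne.symm)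
  exact sub_eq_zero.1 this

lemma continuousAt {z : ℂ} (hz : ω < z.re) : ContinuousAt R z := by
  have hev : ∀ᶠ w in 𝓝 z, ω < w.re :=
    (isOpen_lt continuous_const Complex.continuous_re).mem_nhds hz
  refine tendsto_iff_norm_sub_tendsto_zero.2 ?_
  have hlim : Tendsto (fun w : ℂ => ‖z - w‖ * (M / ω * (M / ω))) (𝓝 z) (𝓝 0) := by
    have : Continuous (fun w : ℂ => ‖z - w‖ * (M / ω * (M / ω))) := by fun_prop
    simpa using this.tendsto z
  refine squeeze_zero' (Eventually.of_forall fun _ => norm_nonneg _) ?_ hlim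
  filter_upwards [hev] with w hw
  rw [h.sub_eq w z hw hz, norm_smul]
  refine mul_le_mul_of_nonneg_left ((norm_mul_le _ _).trans ?_) (norm_nonneg _)
  exact mul_le_mul (h.norm_le_div hw) (h.norm_le_div hz) (norm_nonneg _)
    ((norm_nonneg _).trans (h.norm_le_div hw))

lemma hasDerivAt {z : ℂ} (hz : ω < z.re) : HasDerivAt R (-(R z * R z)) z := by
  have hev : ∀ᶠ w in 𝓝 z, ω < w.re :=
    (isOpen_lt continuous_const Complex.continuous_re).mem_nhds hz
  rw [hasDerivAt_iff_tendsto_slope]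
  have hlim : Tendsto (fun w => -(R w * R z)) (𝓝[≠] z) (𝓝 (-(R z * R z))) :=
    ((h.continuousAt hz).tendsto.mono_left nhdsWithin_le_nhds).mul_const _ |>.neg
  refine hlim.congr' ?_
  filter_upwards [nhdsWithin_le_nhds hev, self_mem_nhdsWithin] with w hw hne
  rw [slope_def_module, h.sub_eq w z hw hz, smul_smul]
  have : w - z ≠ 0 := sub_ne_zero.2 hne
  have h2 : (w - z)⁻¹ * (z - w) = -1 := by field_simp; ring
  rw [h2, neg_one_smul]

lemma hasDerivAt_sq {z : ℂ} (hz : ω < z.re) :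
    HasDerivAt (fun w => R w ^ 2) (-(2 : ℂ) • R z ^ 3) z := by
  have h1 := (h.hasDerivAt hz).mul (h.hasDerivAt hz)
  have e : (fun w => R w ^ 2) = R * R := by ext w; simp [sq]
  rw [e]
  refine h1.congr_deriv ?_
  rw [neg_smul, two_smul]
  noncomm_ring

lemma hasDerivAt_kernel (t : ℂ) {z : ℂ} (hz : ω < z.re) :
    HasDerivAt (fun w => cexp (t * w) • R w ^ 2)
      (t • cexp (t * z) • R z ^ 2 - (2 : ℂ) • cexp (t * z) • R z ^ 3) z := by
  have h1 : HasDerivAt (fun w => cexp (t * w)) (cexp (t * z) * t) z := by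
    simpa using ((hasDerivAt_id z).const_mul t).cexp
  refine (h1.smul (h.hasDerivAt_sq hz)).congr_deriv ?_
  simp only [neg_smul, smul_neg, smul_smul]
  rw [mul_comm (cexp _) t, mul_comm (cexp _) 2]
  abel

lemma continuous_line {c : ℝ} (hc : ω < c) : Continuous fun s => R (vline c s) := by
  rw [continuous_iff_continuousAt]
  intro s
  exact ContinuousAt.comp (f := vline c) (h.continuousAt (by simpa using hc))
    (continuous_vline c).continuousAt

lemma continuous_kernel {c : ℝ} (hc : ω < c) (t : ℝ) (k : ℕ) :
    Continuous fun s => cexp (t * vline c s) • R (vline c s) ^ k :=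
  (by have := continuous_vline c; fun_prop : Continuous fun s => cexp (t * vline c s)).smul
    ((h.continuous_line hc).pow k)

lemma norm_kernel_two_le {c : ℝ} (hc : ω < c) (t s : ℝ) :
    ‖cexp (t * vline c s) • R (vline c s) ^ 2‖ ≤
      Real.exp (t * c) * M ^ 2 * (c ^ 2 + s ^ 2)⁻¹ := by
  rw [norm_smul, norm_cexp_vline, mul_assoc, ← norm_vline_sq, ← div_eq_mul_inv]
  exact mul_le_mul_of_nonneg_left (h.norm_pow_le (by simpa using hc) 2 two_pos) (Real.exp_pos _).le

lemma norm_mul_pow_three_le {z : ℂ} (hz : ω < z.re) : ‖z • R z ^ 3‖ ≤ M ^ 3 / ‖z‖ ^ 2 := by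
  have h0 := h.norm_pos hz
  rw [norm_smul]
  calc ‖z‖ * ‖R z ^ 3‖ ≤ ‖z‖ * (M ^ 3 / ‖z‖ ^ 3) := by
        gcongr; exact h.norm_pow_le hz 3 (by norm_num)
    _ = _ := by field_simp

lemma norm_pow_three_le {z : ℂ} (hz : ω < z.re) : ‖R z ^ 3‖ ≤ M ^ 3 / ω / ‖z‖ ^ 2 := by
  have h0 := h.norm_pos hz
  have hω := h.pos
  have hM := h.M_nonneg
  refine (h.norm_pow_le hz 3 (by norm_num)).trans ?_
  rw [div_div]
  refine div_le_div_of_nonneg_left (by positivity) (by positivity) ?_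
  rw [pow_succ' _ 2]
  gcongr
  exact hz.le.trans (Complex.re_le_norm z)

lemma norm_kernel_three_le {c : ℝ} (hc : ω < c) (t s : ℝ) :
    ‖cexp (t * vline c s) • R (vline c s) ^ 3‖ ≤
      Real.exp (t * c) * (M ^ 3 / ω) * (c ^ 2 + s ^ 2)⁻¹ := by
  rw [norm_smul, norm_cexp_vline, mul_assoc, ← norm_vline_sq, ← div_eq_mul_inv]
  exact mul_le_mul_of_nonneg_left (h.norm_pow_three_le (by simpa using hc)) (Real.exp_pos _).le

lemma integrable_kernel_two {c : ℝ} (hc : ω < c) (t : ℝ) :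
    Integrable fun s => cexp (t * vline c s) • R (vline c s) ^ 2 :=
  ((integrable_inv_sq_add_sq (h.pos.trans hc)).const_mul _).mono'
    (h.continuous_kernel hc t 2).aestronglyMeasurable
    (ae_of_all _ fun s => h.norm_kernel_two_le hc t s)

lemma integrable_kernel_three {c : ℝ} (hc : ω < c) (t : ℝ) :
    Integrable fun s => cexp (t * vline c s) • R (vline c s) ^ 3 :=
  ((integrable_inv_sq_add_sq (h.pos.trans hc)).const_mul _).mono'
    (h.continuous_kernel hc t 3).aestronglyMeasurable
    (ae_of_all _ fun s => h.norm_kernel_three_le hc t s)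

lemma norm_laplaceInt_two_le {c : ℝ} (hc : ω < c) (t : ℝ) :
    ‖laplaceInt R 2 c t‖ ≤ Real.exp (t * c) * M ^ 2 * (Real.pi / c) := by
  rw [← integral_inv_sq_add_sq (h.pos.trans hc), ← integral_const_mul]
  exact norm_integral_le_of_norm_le ((integrable_inv_sq_add_sq (h.pos.trans hc)).const_mul _)
    (ae_of_all _ fun s => h.norm_kernel_two_le hc t s)

end basic

variable (h : IsHalfPlaneResolvent R ω M)
include h

lemma integral_deriv_kernel_eq_zero {c : ℝ} (hc : ω < c) (t : ℝ) :
    ∫ s : ℝ, ((t : ℂ) • cexp (t * vline c s) • R (vline c s) ^ 2 -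
      (2 : ℂ) • cexp (t * vline c s) • R (vline c s) ^ 3) = 0 := by
  have hi : Integrable fun s : ℝ => ((t : ℂ) • cexp (t * vline c s) • R (vline c s) ^ 2 -
      (2 : ℂ) • cexp (t * vline c s) • R (vline c s) ^ 3) :=
    ((h.integrable_kernel_two hc t).smul (t : ℂ)).sub ((h.integrable_kernel_three hc t).smul (2 : ℂ))
  have h0 := integral_eq_zero_of_hasDerivAt_of_integrable
    (f := fun s => cexp (t * vline c s) • R (vline c s) ^ 2)
    (fun s => HasDerivAt.scomp (h := vline c) s
      (h.hasDerivAt_kernel t (by simpa using hc)) (hasDerivAt_vline_right c s))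
    (hi.smul I) (h.integrable_kernel_two hc t)
  rw [integral_smul] at h0
  exact (smul_eq_zero.1 h0).resolve_left I_ne_zero

/-- Integration by parts along the line, using $(R^2)'=-2R^3$. Passing to the cube gains one more
power of decay, which pays for the factor $z$ produced by a time derivative. -/
lemma two_smul_laplaceInt_three {c : ℝ} (hc : ω < c) (t : ℝ) :
    (2 : ℂ) • laplaceInt R 3 c t = (t : ℂ) • laplaceInt R 2 c t := by
  have := h.integral_deriv_kernel_eq_zero hc t
  have i2 : Integrable fun s : ℝ => (t : ℂ) • cexp (t * vline c s) • R (vline c s) ^ 2 :=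
    (h.integrable_kernel_two hc t).smul (t : ℂ)
  have i3 : Integrable fun s : ℝ => (2 : ℂ) • cexp (t * vline c s) • R (vline c s) ^ 3 :=
    (h.integrable_kernel_three hc t).smul (2 : ℂ)
  rw [integral_sub i2 i3, integral_smul, integral_smul] at this
  exact (sub_eq_zero.1 this).symm

/-- For a holomorphic integrand the derivative in the abscissa is, up to the factor $i$, the
derivative along the line, whose integral vanishes. This replaces a contour shift by Cauchy's
theorem. -/
lemma hasDerivAt_laplaceInt_abscissa {c : ℝ} (hc : ω < c) (t : ℝ) :
    HasDerivAt (fun c => laplaceInt R 2 c t) 0 c := by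
  obtain ⟨a, ha, hac⟩ := exists_between hc
  have ha0 := h.pos.trans ha
  have hM := h.M_nonneg
  have hω := h.pos
  have key := hasDerivAt_integral_of_dominated_loc_of_deriv_le (μ := volume)
    (F := fun c s => cexp (t * vline c s) • R (vline c s) ^ 2)
    (F' := fun c s => (t : ℂ) • cexp (t * vline c s) • R (vline c s) ^ 2 -
      (2 : ℂ) • cexp (t * vline c s) • R (vline c s) ^ 3)
    (bound := fun s => (Real.exp (|t| * (c + 1)) * (|t| * M ^ 2 + 2 * (M ^ 3 / ω))) *
      (a ^ 2 + s ^ 2)⁻¹)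
    (s := Set.Ioo a (c + 1)) (x₀ := c) (Ioo_mem_nhds hac (by linarith))
    ?_ (h.integrable_kernel_two hc t) ?_ ?_ ((integrable_inv_sq_add_sq ha0).const_mul _) ?_
  · have := key.2
    rwa [h.integral_deriv_kernel_eq_zero hc t] at this
  · filter_upwards [Ioi_mem_nhds hc] with x hx
    exact (h.continuous_kernel hx t 2).aestronglyMeasurable
  · exact (((h.continuous_kernel hc t 2).const_smul _).sub
      ((h.continuous_kernel hc t 3).const_smul _)).aestronglyMeasurable
  · refine ae_of_all _ fun s x hx => ?_
    have hx' : ω < x := ha.trans hx.1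
    have e1 : Real.exp (t * x) ≤ Real.exp (|t| * (c + 1)) := by
      apply Real.exp_le_exp.2
      calc t * x ≤ |t| * x := by
            apply mul_le_mul_of_nonneg_right (le_abs_self t) (h.pos.trans hx').le
        _ ≤ |t| * (c + 1) := by gcongr; exact hx.2.le
    have e2 : (x ^ 2 + s ^ 2)⁻¹ ≤ (a ^ 2 + s ^ 2)⁻¹ := by
      gcongr; exact hx.1.le
    calc ‖(t : ℂ) • cexp (t * vline x s) • R (vline x s) ^ 2 -
            (2 : ℂ) • cexp (t * vline x s) • R (vline x s) ^ 3‖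
        ≤ |t| * ‖cexp (t * vline x s) • R (vline x s) ^ 2‖ +
            2 * ‖cexp (t * vline x s) • R (vline x s) ^ 3‖ := by
          refine (norm_sub_le _ _).trans (le_of_eq ?_)
          rw [norm_smul (t : ℂ), norm_smul (2 : ℂ)]; simp
      _ ≤ |t| * (Real.exp (t * x) * M ^ 2 * (x ^ 2 + s ^ 2)⁻¹) +
            2 * (Real.exp (t * x) * (M ^ 3 / ω) * (x ^ 2 + s ^ 2)⁻¹) := by
          gcongr
          · exact h.norm_kernel_two_le hx' t s
          · exact h.norm_kernel_three_le hx' t s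
      _ = Real.exp (t * x) * (|t| * M ^ 2 + 2 * (M ^ 3 / ω)) * (x ^ 2 + s ^ 2)⁻¹ := by ring
      _ ≤ _ := by gcongr
  · refine ae_of_all _ fun s x hx => ?_
    have hx' : ω < x := ha.trans hx.1
    have := HasDerivAt.scomp (h := fun y : ℝ => vline y s) x
      (h.hasDerivAt_kernel t (z := vline x s) (by simpa using hx')) (hasDerivAt_vline_left x s)
    rwa [one_smul] at this

lemma laplaceInt_eq {c c' : ℝ} (hc : ω < c) (hc' : ω < c') (t : ℝ) :
    laplaceInt R 2 c t = laplaceInt R 2 c' t :=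
  isOpen_Ioi.is_const_of_deriv_eq_zero isPreconnected_Ioi
    (fun _ hx => (h.hasDerivAt_laplaceInt_abscissa hx t).differentiableAt.differentiableWithinAt)
    (fun _ hx => (h.hasDerivAt_laplaceInt_abscissa hx t).deriv) hc hc'

lemma laplaceSemigroup_eq_two {c t : ℝ} (hc : ω < c) (ht : 0 < t) :
    laplaceSemigroup R ω t = ((2 * Real.pi * t : ℝ) : ℂ)⁻¹ • laplaceInt R 2 c t := by
  rw [laplaceSemigroup, if_neg (not_le.2 ht), h.laplaceInt_eq (c' := c) _ hc]
  have : 0 < 1 / t := by positivity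
  linarith

lemma laplaceSemigroup_eq_three {c t : ℝ} (hc : ω < c) (ht : 0 < t) :
    laplaceSemigroup R ω t = ((Real.pi * t ^ 2 : ℝ) : ℂ)⁻¹ • laplaceInt R 3 c t := by
  have h3 := h.two_smul_laplaceInt_three hc t
  have : laplaceInt R 3 c t = (2 : ℂ)⁻¹ • (t : ℂ) • laplaceInt R 2 c t := by
    rw [← h3, smul_smul, inv_mul_cancel₀ two_ne_zero, one_smul]
  rw [this, h.laplaceSemigroup_eq_two hc ht, smul_smul, smul_smul]
  congr 1
  have : (t : ℂ) ≠ 0 := by exact_mod_cast ht.ne'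
  have hp : (Real.pi : ℂ) ≠ 0 := by exact_mod_cast Real.pi_ne_zero
  push_cast
  field_simp

/-- The abscissa $\omega+1/t$ keeps $e^{tc}$ equal to $e^{\omega t+1}$ while $1/c\le t$ cancels the
prefactor $1/t$, so the bound is uniform as $t\downarrow0$. -/
lemma norm_laplaceSemigroup_le {t : ℝ} (ht : 0 < t) :
    ‖laplaceSemigroup R ω t‖ ≤ M ^ 2 * Real.exp (ω * t + 1) / 2 := by
  have hω := h.pos
  have hc : ω < ω + 1 / t := by have : 0 < 1 / t := by positivity
                                linarith
  rw [h.laplaceSemigroup_eq_two hc ht, norm_smul, norm_inv, Complex.norm_real, Real.norm_eq_abs,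
    abs_of_pos (by positivity)]
  have h1 := h.norm_laplaceInt_two_le hc t
  have e : t * (ω + 1 / t) = ω * t + 1 := by field_simp
  rw [e] at h1
  calc (2 * Real.pi * t)⁻¹ * ‖laplaceInt R 2 (ω + 1 / t) t‖
      ≤ (2 * Real.pi * t)⁻¹ * (Real.exp (ω * t + 1) * M ^ 2 * (Real.pi / (ω + 1 / t))) := by
        gcongr
    _ = M ^ 2 * Real.exp (ω * t + 1) / 2 / (ω * t + 1) := by field_simp
    _ ≤ _ := by
        apply div_le_self (by positivity)
        have : 0 < ω * t := by positivity
        linarith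

lemma hasDerivAt_laplaceInt_three {c : ℝ} (hc : ω < c) (t : ℝ) :
    Integrable (fun s => cexp (t * vline c s) • vline c s • R (vline c s) ^ 3) ∧
    HasDerivAt (fun t => laplaceInt R 3 c t)
      (∫ s : ℝ, cexp (t * vline c s) • vline c s • R (vline c s) ^ 3) t := by
  have hc0 := h.pos.trans hc
  have hM := h.M_nonneg
  have hcont : ∀ x : ℝ, Continuous
      fun s => cexp (x * vline c s) • vline c s • R (vline c s) ^ 3 := fun x =>
    (by have := continuous_vline c; fun_prop : Continuous fun s => cexp (x * vline c s)).smul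
      ((continuous_vline c).smul ((h.continuous_line hc).pow 3))
  refine hasDerivAt_integral_of_dominated_loc_of_deriv_le (μ := volume)
    (F := fun t s => cexp ((t : ℝ) * vline c s) • R (vline c s) ^ 3)
    (F' := fun t s => cexp (t * vline c s) • vline c s • R (vline c s) ^ 3)
    (bound := fun s => (Real.exp ((t + 1) * c) * M ^ 3) * (c ^ 2 + s ^ 2)⁻¹)
    (s := Set.Iio (t + 1)) (x₀ := t) (Iio_mem_nhds (by linarith))
    ?_ (h.integrable_kernel_three hc t) (hcont t).aestronglyMeasurable ?_
    ((integrable_inv_sq_add_sq hc0).const_mul _) ?_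
  · exact Eventually.of_forall fun x => (h.continuous_kernel hc x 3).aestronglyMeasurable
  · refine ae_of_all _ fun s x hx => ?_
    rw [norm_smul, norm_cexp_vline, mul_assoc, ← norm_vline_sq, ← div_eq_mul_inv]
    refine mul_le_mul (Real.exp_le_exp.2 ?_) (h.norm_mul_pow_three_le (by simpa using hc))
      (norm_nonneg _) (Real.exp_pos _).le
    exact mul_le_mul_of_nonneg_right (le_of_lt hx) hc0.le
  · refine ae_of_all _ fun s x _ => ?_
    have h1 : HasDerivAt (fun x : ℝ => cexp (x * vline c s))
        (cexp (x * vline c s) * vline c s) x := by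
      simpa using ((Complex.ofRealCLM.hasDerivAt (x := x)).mul_const (vline c s)).cexp
    refine (h1.smul_const _).congr_deriv ?_
    rw [smul_smul]

/-- `S' = μ S - (μ - T) S`, where `R μ` inverts `μ - T`. -/
lemma exists_hasDerivAt {t : ℝ} (ht : 0 < t) :
    ∃ D : A, HasDerivAt (laplaceSemigroup R ω) D t ∧ ∀ μ : ℂ, ω < μ.re →
      R μ * (μ • laplaceSemigroup R ω t - D) = laplaceSemigroup R ω t ∧ R μ * D = D * R μ ∧
      R μ * laplaceSemigroup R ω t = laplaceSemigroup R ω t * R μ := by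
  obtain ⟨c, hc⟩ := exists_gt ω
  obtain ⟨hint, hder⟩ := h.hasDerivAt_laplaceInt_three hc t
  set L := ∫ s : ℝ, cexp (t * vline c s) • vline c s • R (vline c s) ^ 3 with hL
  have ht' : (t : ℂ) ≠ 0 := by exact_mod_cast ht.ne'
  have hp : (Real.pi : ℂ) ≠ 0 := by exact_mod_cast Real.pi_ne_zero
  have h3 := h.two_smul_laplaceInt_three hc t
  have comm_int : ∀ (f : ℝ → A) (μ : ℂ), Integrable f → (∀ s, R μ * f s = f s * R μ) →
      R μ * ∫ s, f s = (∫ s, f s) * R μ := by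
    intro f μ hf hcm
    rw [← integral_const_mul_of_integrable hf, ← integral_mul_const_of_integrable hf]
    simp_rw [hcm]
  have c2 : ∀ μ : ℂ, ω < μ.re → R μ * laplaceInt R 2 c t = laplaceInt R 2 c t * R μ := by
    intro μ hμ
    refine comm_int _ _ (h.integrable_kernel_two hc t) fun s => ?_
    have : Commute (R μ) (R (vline c s)) := h.comm hμ (by simpa using hc)
    exact (this.pow_right 2).smul_right _
  have cL : ∀ μ : ℂ, ω < μ.re → R μ * L = L * R μ := by
    intro μ hμ
    refine comm_int _ _ hint fun s => ?_
    have : Commute (R μ) (R (vline c s)) := h.comm hμ (by simpa using hc)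
    exact ((this.pow_right 3).smul_right _).smul_right _
  have hS : ∀ x, 0 < x → laplaceSemigroup R ω x = ((Real.pi * x ^ 2 : ℝ) : ℂ)⁻¹ •
    laplaceInt R 3 c x := fun x hx => h.laplaceSemigroup_eq_three hc hx
  -- Under the integral sign this is the resolvent identity $R(z)=R(\mu)+(\mu-z)R(\mu)R(z)$
  -- multiplied by $R(z)^2$.
  have key : ∀ μ : ℂ, ω < μ.re → R μ * (μ • laplaceInt R 3 c t - (L - laplaceInt R 2 c t)) =
      laplaceInt R 3 c t := by
    intro μ hμ
    have e : μ • laplaceInt R 3 c t - (L - laplaceInt R 2 c t) =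
        ∫ s : ℝ, (μ • cexp (t * vline c s) • R (vline c s) ^ 3 -
          (cexp (t * vline c s) • vline c s • R (vline c s) ^ 3 -
          cexp (t * vline c s) • R (vline c s) ^ 2)) := by
      have i1 : Integrable fun s : ℝ => μ • cexp (t * vline c s) • R (vline c s) ^ 3 :=
        (h.integrable_kernel_three hc t).smul μ
      have i2 : Integrable fun s : ℝ => cexp (t * vline c s) • vline c s • R (vline c s) ^ 3 -
          cexp (t * vline c s) • R (vline c s) ^ 2 := hint.sub (h.integrable_kernel_two hc t)
      rw [integral_sub i1 i2, integral_sub hint (h.integrable_kernel_two hc t), integral_smul]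
      rfl
    have hI : Integrable fun s : ℝ => (μ • cexp (t * vline c s) • R (vline c s) ^ 3 -
          (cexp (t * vline c s) • vline c s • R (vline c s) ^ 3 -
          cexp (t * vline c s) • R (vline c s) ^ 2)) :=
      ((h.integrable_kernel_three hc t).smul μ).sub (hint.sub (h.integrable_kernel_two hc t))
    rw [e, ← integral_const_mul_of_integrable hI, laplaceInt]
    congr 1
    ext s
    have hz : ω < (vline c s).re := by simpa using hc
    have hr := h.sub_eq _ _ hz hμ
    rw [h.comm hz hμ] at hr
    generalize vline c s = z at hr ⊢
    have : R z ^ 3 = (R μ + (μ - z) • (R μ * R z)) * R z ^ 2 := by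
      rw [← hr, pow_succ']; congr 1; abel
    conv_rhs => rw [this]
    simp only [pow_succ, pow_zero, one_mul, mul_sub, mul_smul_comm, add_mul, sub_mul,
      smul_mul_assoc, smul_add, sub_smul, smul_sub, mul_assoc]
    simp only [smul_smul]
    rw [mul_comm μ]
    abel
  refine ⟨((Real.pi * t ^ 2 : ℝ) : ℂ)⁻¹ • (L - laplaceInt R 2 c t), ?_, ?_⟩
  · have h1 : HasDerivAt (fun x : ℝ => ((Real.pi * x ^ 2 : ℝ) : ℂ)⁻¹)
        (-2 * (Real.pi * t ^ 3 : ℂ)⁻¹) t := by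
      have h2 : HasDerivAt (fun x : ℝ => ((Real.pi * x ^ 2 : ℝ) : ℂ)) ((Real.pi * (2 * t) : ℝ) : ℂ) t := by
        have := ((hasDerivAt_pow 2 t).const_mul Real.pi).ofReal_comp
        simpa using this
      refine (h2.inv (by simp [ht', hp])).congr_deriv ?_
      push_cast
      field_simp
    have h4 := h1.smul hder
    refine (h4.congr_deriv ?_).congr_of_eventuallyEq ?_
    -- Differentiating the prefactor $1/(\pi t^2)$ gives $-2/t$ times the cubic integral, which
    -- integration by parts turns into minus the quadratic one.
    · have e2 : laplaceInt R 2 c t = (t : ℂ)⁻¹ • (2 : ℂ) • laplaceInt R 3 c t := by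
        rw [h3, smul_smul, inv_mul_cancel₀ ht', one_smul]
      rw [e2, smul_sub, smul_smul, smul_smul, sub_eq_add_neg, ← neg_smul]
      congr 2
      push_cast
      field_simp
    · filter_upwards [Ioi_mem_nhds ht] with x hx
      exact hS x hx
  · intro μ hμ
    have c3 : R μ * laplaceInt R 3 c t = laplaceInt R 3 c t * R μ := by
      have e2 : laplaceInt R 3 c t = (2 : ℂ)⁻¹ • (t : ℂ) • laplaceInt R 2 c t := by
        rw [← h3, smul_smul, inv_mul_cancel₀ two_ne_zero, one_smul]
      rw [e2, mul_smul_comm, mul_smul_comm, c2 μ hμ, smul_mul_assoc, smul_mul_assoc]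
    refine ⟨?_, ?_, ?_⟩
    · rw [hS t ht, smul_comm, ← smul_sub, mul_smul_comm, key μ hμ]
    · rw [mul_smul_comm, smul_mul_assoc, mul_sub, sub_mul, cL μ hμ, c2 μ hμ]
    · rw [hS t ht, mul_smul_comm, smul_mul_assoc, c3]

end IsHalfPlaneResolvent

end OperatorSemigroup

/-! ### Behaviour at time zero, dependence on the resolvent, compactness -/

namespace OperatorSemigroup

open MeasureTheory Complex

lemma mellin_indicator_one_sub_id {z : ℂ} (hz : 0 < z.re) :
    HasMellin (fun t : ℝ => Set.indicator (Set.Ioc 0 1) (fun _ => (1 : ℂ)) t -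
      Set.indicator (Set.Ioc 0 1) (fun t : ℝ => (t : ℂ) ^ (1 : ℂ)) t) z (1 / z - 1 / (z + 1)) := by
  have h1 := hasMellin_one_Ioc hz
  have h2 := hasMellin_cpow_Ioc 1 (s := z) (by simp; linarith)
  have := hasMellin_sub h1.1 h2.1
  rwa [h1.2, h2.2] at this

lemma one_div_sub_one_div_add_one {z : ℂ} (hz : 0 < z.re) :
    1 / z - 1 / (z + 1) = (z * (z + 1))⁻¹ := by
  have h0 : z ≠ 0 := by rintro rfl; simp at hz
  have h1 : z + 1 ≠ 0 := by
    intro h; have := congrArg Complex.re h; simp at this; linarith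
  field_simp
  ring

lemma norm_le_norm_add_one {z : ℂ} (hz : 0 < z.re) : ‖z‖ ≤ ‖z + 1‖ := by
  rw [← sq_le_sq₀ (norm_nonneg _) (norm_nonneg _), ← Complex.normSq_eq_norm_sq,
    ← Complex.normSq_eq_norm_sq, Complex.normSq_apply, Complex.normSq_apply]
  simp
  nlinarith

lemma integrable_inv_mul_add_one {c : ℝ} (hc : 0 < c) :
    Integrable fun s : ℝ => (vline c s * (vline c s + 1))⁻¹ := by
  refine (integrable_inv_sq_add_sq hc).mono' ?_ (ae_of_all _ fun s => ?_)
  · have := continuous_vline c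
    refine Continuous.aestronglyMeasurable (Continuous.inv₀ (by fun_prop) fun s h => ?_)
    have hz : 0 < (vline c s).re := by simpa using hc
    rcases mul_eq_zero.1 h with h | h
    · rw [h] at hz; simp at hz
    · have := congrArg Complex.re h; simp at this; linarith
  · have hz : 0 < (vline c s).re := by simpa using hc
    have h0 : 0 < ‖vline c s‖ := hz.trans_le (Complex.re_le_norm _)
    rw [norm_inv, norm_mul, ← norm_vline_sq, sq]
    gcongr
    exact norm_le_norm_add_one hz

/-- Mellin inversion for $f(x)=1-x$ on $(0,1]$, evaluated at $x=e^{-t}$. This is the scalar model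
against which $R(z)^2R(\mu)$ is compared near $t=0$. -/
lemma integral_cexp_mul_inv_mul_add_one {c t : ℝ} (hc : 0 < c) (ht : 0 < t) :
    ∫ s : ℝ, cexp (t * vline c s) * (vline c s * (vline c s + 1))⁻¹ =
      ((2 * Real.pi * (1 - Real.exp (-t)) : ℝ) : ℂ) := by
  set f : ℝ → ℂ := fun t : ℝ => Set.indicator (Set.Ioc 0 1) (fun _ => (1 : ℂ)) t -
      Set.indicator (Set.Ioc 0 1) (fun t : ℝ => (t : ℂ) ^ (1 : ℂ)) t with hf
  have hm : ∀ s : ℝ, mellin f (vline c s) = (vline c s * (vline c s + 1))⁻¹ := fun s => by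
    have hz : 0 < (vline c s).re := by simpa using hc
    rw [(mellin_indicator_one_sub_id hz).2, one_div_sub_one_div_add_one hz]
  have hx1 : Real.exp (-t) < 1 := by simpa using ht
  have hfx : ∀ x ∈ Set.Ioo (0 : ℝ) 1, f x = 1 - x := fun x hx => by
    have : x ∈ Set.Ioc (0 : ℝ) 1 := ⟨hx.1, hx.2.le⟩
    simp [hf, this]
  have hev : f =ᶠ[𝓝 (Real.exp (-t))] fun x => 1 - (x : ℂ) := by
    filter_upwards [Ioo_mem_nhds (Real.exp_pos _) hx1] with x hx using hfx x hx
  have key := mellinInv_mellin_eq c f (Real.exp_pos (-t))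
    (mellin_indicator_one_sub_id (z := c) (by simpa using hc)).1
    ((integrable_inv_mul_add_one hc).congr (ae_of_all _ fun s => (hm s).symm))
    ((by fun_prop : Continuous fun x : ℝ => 1 - (x : ℂ)).continuousAt.congr hev.symm)
  rw [hfx _ ⟨Real.exp_pos _, hx1⟩, mellinInv] at key
  have e : ∀ s : ℝ, ((Real.exp (-t) : ℝ) : ℂ) ^ (-((c : ℂ) + s * I)) • mellin f (c + s * I) =
      cexp (t * vline c s) * (vline c s * (vline c s + 1))⁻¹ := fun s => by
    rw [← hm s, smul_eq_mul]
    congr 1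
    rw [Complex.cpow_def_of_ne_zero (by exact_mod_cast (Real.exp_pos _).ne'),
      ← Complex.ofReal_log (Real.exp_pos _).le, Real.log_exp]
    congr 1
    simp only [vline]; push_cast; ring
  simp_rw [e] at key
  rw [one_div, inv_smul_eq_iff₀ (by positivity)] at key
  rw [key, Complex.real_smul]
  push_cast
  ring

variable {A : Type*} [NormedRing A] [NormedAlgebra ℂ A]

namespace IsHalfPlaneResolvent

variable {R R' : ℂ → A} {ω M : ℝ}

/-- $R^2-R'^2=R(R-R')+(R-R')R'$ is $O(\varepsilon/|z|^2)$, so the difference of the integrals is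
estimated as in the bound for one semigroup. -/
lemma norm_laplaceSemigroup_sub_le (h : IsHalfPlaneResolvent R ω M)
    (h' : IsHalfPlaneResolvent R' ω M) {ε : ℝ}
    (hε : ∀ z : ℂ, ω < z.re → ‖R z - R' z‖ ≤ ε / ‖z‖) {t : ℝ} (ht : 0 < t) :
    ‖laplaceSemigroup R ω t - laplaceSemigroup R' ω t‖ ≤ M * Real.exp (ω * t + 1) * ε := by
  have hω := h.pos
  have hM := h.M_nonneg
  have ht1 : 0 < 1 / t := by positivity
  have hc : ω < ω + 1 / t := by linarith
  have hc0 := hω.trans hc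
  have hε0 : 0 ≤ ε := by
    have hz : ω < ((ω + 1 : ℝ) : ℂ).re := by simp
    have h1 := (norm_nonneg _).trans (hε _ hz)
    have h2 := h.norm_pos hz
    by_contra hM
    exact absurd h1 (not_le.2 (div_neg_of_neg_of_pos (not_le.1 hM) h2))
  rw [h.laplaceSemigroup_eq_two hc ht, h'.laplaceSemigroup_eq_two hc ht, ← smul_sub, norm_smul,
    norm_inv, Complex.norm_real, Real.norm_eq_abs, abs_of_pos (by positivity), laplaceInt,
    laplaceInt, ← integral_sub (h.integrable_kernel_two hc t) (h'.integrable_kernel_two hc t)]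
  have e : t * (ω + 1 / t) = ω * t + 1 := by field_simp
  have hb : ∀ s : ℝ, ‖cexp (t * vline (ω + 1 / t) s) • R (vline (ω + 1 / t) s) ^ 2 -
      cexp (t * vline (ω + 1 / t) s) • R' (vline (ω + 1 / t) s) ^ 2‖ ≤
      (Real.exp (ω * t + 1) * (2 * M * ε)) * ((ω + 1 / t) ^ 2 + s ^ 2)⁻¹ := fun s => by
    have hz : ω < (vline (ω + 1 / t) s).re := by simpa using hc
    rw [← smul_sub, norm_smul, norm_cexp_vline, e, mul_assoc, ← norm_vline_sq]
    gcongr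
    generalize vline (ω + 1 / t) s = z at hz ⊢
    have hz0 := h.norm_pos hz
    have : R z ^ 2 - R' z ^ 2 = R z * (R z - R' z) + (R z - R' z) * R' z := by noncomm_ring
    rw [this]
    calc _ ≤ ‖R z‖ * ‖R z - R' z‖ + ‖R z - R' z‖ * ‖R' z‖ :=
          (norm_add_le _ _).trans (add_le_add (norm_mul_le _ _) (norm_mul_le _ _))
      _ ≤ (M / ‖z‖) * (ε / ‖z‖) + (ε / ‖z‖) * (M / ‖z‖) := by
          gcongr
          exacts [h.norm_le z hz, hε z hz, hε z hz, h'.norm_le z hz]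
      _ = _ := by field_simp; ring
  have hI := norm_integral_le_of_norm_le ((integrable_inv_sq_add_sq hc0).const_mul _)
    (ae_of_all volume hb)
  rw [integral_const_mul, integral_inv_sq_add_sq hc0] at hI
  calc _ ≤ (2 * Real.pi * t)⁻¹ * (Real.exp (ω * t + 1) * (2 * M * ε) * (Real.pi / (ω + 1 / t))) := by
        gcongr
    _ = M * Real.exp (ω * t + 1) * ε / (ω * t + 1) := by field_simp
    _ ≤ _ := by
        apply div_le_self (by positivity)
        have : 0 < ω * t := by positivity
        linarith

variable (h : IsHalfPlaneResolvent R ω M)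
include h

/-- With $B=\mu R(\mu)-1$ one has $R(z)R(\mu)=z^{-1}(R(\mu)+R(z)B)$. Using this twice extracts
$z^{-2}R(\mu)$, which differs from the model term by $R(\mu)/(z^2(z+1))$. The cubic decay yields an
error of order $t$ after integration. -/
lemma norm_sq_mul_sub_le {z μ : ℂ} (hz : ω < z.re) (hμ : ω < μ.re) :
    ‖R z ^ 2 * R μ - (z * (z + 1))⁻¹ • R μ‖ ≤
      (‖R μ‖ + (M + M ^ 2) * ‖μ • R μ - 1‖) / ‖z‖ ^ 3 := by
  set B := μ • R μ - 1 with hB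
  have hM := h.M_nonneg
  have hz0 := h.norm_pos hz
  have hzne : z ≠ 0 := norm_pos_iff.1 hz0
  have hzre : 0 < z.re := h.pos.trans hz
  have h1 : z + 1 ≠ 0 := by
    intro h; have := congrArg Complex.re h; simp at this; linarith
  have e1 : R z * R μ = z⁻¹ • R μ + z⁻¹ • (R z * B) := by
    rw [← smul_add, eq_inv_smul_iff₀ hzne, hB, mul_sub, mul_one, mul_smul_comm]
    have := h.sub_eq z μ hz hμ
    have e : R z = R μ + (μ - z) • (R z * R μ) := by rw [← this]; abel
    rw [sub_smul] at e
    calc z • (R z * R μ) = R μ + (μ • (R z * R μ) -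
          (R μ + (μ • (R z * R μ) - z • (R z * R μ)))) := by abel
      _ = _ := by rw [← e]
  have e2 : R z ^ 2 * R μ - (z * (z + 1))⁻¹ • R μ =
      (z ^ 2 * (z + 1))⁻¹ • R μ + ((z ^ 2)⁻¹ • (R z * B) + z⁻¹ • (R z ^ 2 * B)) := by
    have : R z ^ 2 * R μ = z⁻¹ • (z⁻¹ • R μ + z⁻¹ • (R z * B)) + z⁻¹ • (R z ^ 2 * B) := by
      rw [sq, mul_assoc, e1, mul_add, mul_smul_comm, mul_smul_comm, e1, mul_assoc]
    rw [this, smul_add, smul_smul, smul_smul]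
    have e3 : (z ^ 2 * (z + 1))⁻¹ = z⁻¹ * z⁻¹ - (z * (z + 1))⁻¹ := by
      field_simp; ring
    rw [e3, sub_smul, sq z, mul_inv z z]
    abel
  rw [e2]
  have n1 : ‖(z ^ 2 * (z + 1))⁻¹ • R μ‖ ≤ ‖R μ‖ / ‖z‖ ^ 3 := by
    rw [norm_smul, norm_inv, norm_mul, norm_pow, mul_comm, ← div_eq_mul_inv, pow_succ ‖z‖ 2]
    gcongr
    exact norm_le_norm_add_one hzre
  have n2 : ‖(z ^ 2)⁻¹ • (R z * B)‖ ≤ M * ‖B‖ / ‖z‖ ^ 3 := by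
    rw [norm_smul, norm_inv, norm_pow]
    calc (‖z‖ ^ 2)⁻¹ * ‖R z * B‖ ≤ (‖z‖ ^ 2)⁻¹ * ((M / ‖z‖) * ‖B‖) := by
          gcongr
          exact (norm_mul_le _ _).trans (by gcongr; exact h.norm_le z hz)
      _ = _ := by field_simp
  have n3 : ‖z⁻¹ • (R z ^ 2 * B)‖ ≤ M ^ 2 * ‖B‖ / ‖z‖ ^ 3 := by
    rw [norm_smul, norm_inv]
    calc ‖z‖⁻¹ * ‖R z ^ 2 * B‖ ≤ ‖z‖⁻¹ * ((M ^ 2 / ‖z‖ ^ 2) * ‖B‖) := by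
          gcongr
          exact (norm_mul_le _ _).trans (by gcongr; exact h.norm_pow_le hz 2 two_pos)
      _ = _ := by field_simp
  calc _ ≤ ‖R μ‖ / ‖z‖ ^ 3 + (M * ‖B‖ / ‖z‖ ^ 3 + M ^ 2 * ‖B‖ / ‖z‖ ^ 3) :=
        (norm_add_le _ _).trans (add_le_add n1 ((norm_add_le _ _).trans (add_le_add n2 n3)))
    _ = _ := by ring

variable [CompleteSpace A]

lemma norm_laplaceSemigroup_mul_sub_le {μ : ℂ} (hμ : ω < μ.re) {t : ℝ} (ht : 0 < t) :
    ‖laplaceSemigroup R ω t * R μ - (((1 - Real.exp (-t)) / t : ℝ) : ℂ) • R μ‖ ≤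
      Real.exp (ω * t + 1) * (‖R μ‖ + (M + M ^ 2) * ‖μ • R μ - 1‖) * t := by
  have hω := h.pos
  have hM := h.M_nonneg
  have ht1 : 0 < 1 / t := by positivity
  have hc : ω < ω + 1 / t := by linarith
  have hc0 := hω.trans hc
  set c := ω + 1 / t with hcdef
  set K := ‖R μ‖ + (M + M ^ 2) * ‖μ • R μ - 1‖ with hK
  have hK0 : 0 ≤ K := by positivity
  have e : t * c = ω * t + 1 := by rw [hcdef]; field_simp
  have ht' : (t : ℂ) ≠ 0 := by exact_mod_cast ht.ne'
  have hp : (Real.pi : ℂ) ≠ 0 := by exact_mod_cast Real.pi_ne_zero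
  have i1 := h.integrable_kernel_two hc t
  have i2 : Integrable fun s => cexp (t * vline c s) * (vline c s * (vline c s + 1))⁻¹ := by
    refine (integrable_inv_mul_add_one hc0).bdd_mul (c := Real.exp (t * c)) ?_ ?_
    · have := continuous_vline c
      exact Continuous.aestronglyMeasurable (by fun_prop)
    · exact ae_of_all _ fun s => (norm_cexp_vline t c s).le
  have i1' : Integrable fun s => (cexp (t * vline c s) • R (vline c s) ^ 2) * R μ :=
    i1.mul_const _
  have i2' : Integrable fun s =>
    (cexp (t * vline c s) * (vline c s * (vline c s + 1))⁻¹) • R μ := i2.smul_const _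
  have e2 : laplaceSemigroup R ω t * R μ - (((1 - Real.exp (-t)) / t : ℝ) : ℂ) • R μ =
      ((2 * Real.pi * t : ℝ) : ℂ)⁻¹ • ∫ s : ℝ,
        ((cexp (t * vline c s) • R (vline c s) ^ 2) * R μ -
        (cexp (t * vline c s) * (vline c s * (vline c s + 1))⁻¹) • R μ) := by
    rw [integral_sub i1' i2', integral_mul_const_of_integrable i1, integral_smul_const,
      integral_cexp_mul_inv_mul_add_one hc0 ht, smul_sub, h.laplaceSemigroup_eq_two hc ht,
      smul_mul_assoc, smul_smul, laplaceInt]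
    congr 2
    push_cast
    field_simp
  rw [e2, norm_smul, norm_inv, Complex.norm_real, Real.norm_eq_abs, abs_of_pos (by positivity)]
  have hb : ∀ s : ℝ, ‖(cexp (t * vline c s) • R (vline c s) ^ 2) * R μ -
        (cexp (t * vline c s) * (vline c s * (vline c s + 1))⁻¹) • R μ‖ ≤
      (Real.exp (ω * t + 1) * (K / c)) * (c ^ 2 + s ^ 2)⁻¹ := fun s => by
    have hz : ω < (vline c s).re := by simpa using hc
    have hcz := le_norm_vline c s
    rw [smul_mul_assoc, mul_smul, ← smul_sub, norm_smul, norm_cexp_vline, e, mul_assoc,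
      ← norm_vline_sq]
    gcongr
    refine (h.norm_sq_mul_sub_le hz hμ).trans ?_
    have hz0 := h.norm_pos hz
    rw [← hK, ← div_eq_mul_inv, div_div, pow_succ' _ 2]
    gcongr
  have hI := norm_integral_le_of_norm_le ((integrable_inv_sq_add_sq hc0).const_mul _)
    (ae_of_all volume hb)
  rw [integral_const_mul, integral_inv_sq_add_sq hc0] at hI
  have htc : 1 ≤ t * c := by rw [e]; have : 0 < ω * t := by positivity
                             linarith
  calc _ ≤ (2 * Real.pi * t)⁻¹ * (Real.exp (ω * t + 1) * (K / c) * (Real.pi / c)) := by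
        gcongr
    _ = Real.exp (ω * t + 1) * K * t * (2 * (t * c) ^ 2)⁻¹ := by field_simp
    _ ≤ Real.exp (ω * t + 1) * K * t * 1 := by
        gcongr
        apply inv_le_one_of_one_le₀
        nlinarith
    _ = _ := mul_one _

lemma tendsto_laplaceSemigroup_mul {μ : ℂ} (hμ : ω < μ.re) :
    Tendsto (fun t => laplaceSemigroup R ω t * R μ) (𝓝[>] 0) (𝓝 (R μ)) := by
  have h1 : Tendsto (fun t : ℝ => (((1 - Real.exp (-t)) / t : ℝ) : ℂ) • R μ) (𝓝[>] 0)
      (𝓝 (R μ)) := by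
    have hd : HasDerivAt (fun t : ℝ => -Real.exp (-t)) 1 0 := by
      have := ((hasDerivAt_neg (0 : ℝ)).exp).fun_neg
      simpa using this
    have h2 := (hasDerivAt_iff_tendsto_slope_zero.1 hd).mono_left
      (nhdsWithin_mono 0 (fun x (hx : x ∈ Set.Ioi (0:ℝ)) => (ne_of_gt hx : x ≠ 0)))
    have h3 := ((Complex.continuous_ofReal.tendsto _).comp h2).smul_const (R μ)
    simp only [Complex.ofReal_one, one_smul] at h3
    refine h3.congr fun t => ?_
    simp only [Function.comp, zero_add, neg_zero, Real.exp_zero, smul_eq_mul]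
    congr 2
    ring
  have h2 : Tendsto (fun t : ℝ => Real.exp (ω * t + 1) *
      (‖R μ‖ + (M + M ^ 2) * ‖μ • R μ - 1‖) * t) (𝓝[>] 0) (𝓝 0) := by
    have : Continuous (fun t : ℝ => Real.exp (ω * t + 1) *
      (‖R μ‖ + (M + M ^ 2) * ‖μ • R μ - 1‖) * t) := by fun_prop
    simpa using (this.tendsto 0).mono_left nhdsWithin_le_nhds
  have h3 : Tendsto (fun t : ℝ => laplaceSemigroup R ω t * R μ -
      (((1 - Real.exp (-t)) / t : ℝ) : ℂ) • R μ) (𝓝[>] 0) (𝓝 0) := by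
    refine squeeze_zero_norm' ?_ h2
    filter_upwards [self_mem_nhdsWithin] with t ht
    exact h.norm_laplaceSemigroup_mul_sub_le hμ ht
  simpa using h3.add h1

/-- An integral of values in a closed subspace stays in it. Applied to the compact operators, it
makes the semigroup compact at positive times. -/
lemma laplaceSemigroup_mem {K : Submodule ℂ A} (hK : IsClosed (K : Set A))
    (hR : ∀ z : ℂ, ω < z.re → R z ^ 2 ∈ K) {t : ℝ} (ht : 0 < t) :
    laplaceSemigroup R ω t ∈ K := by
  obtain ⟨c, hc⟩ := exists_gt ω
  have : CompleteSpace K := hK.completeSpace_coe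
  rw [h.laplaceSemigroup_eq_two hc ht]
  refine K.smul_mem _ ?_
  let f : ℝ → K := fun s => ⟨cexp (t * vline c s) • R (vline c s) ^ 2,
    K.smul_mem _ (hR _ (by simpa using hc))⟩
  have hf : Integrable f := by
    refine ⟨((h.continuous_kernel hc t 2).subtype_mk _).aestronglyMeasurable, ?_⟩
    exact (h.integrable_kernel_two hc t).2
  have := K.subtypeL.integral_comp_comm hf
  have e : laplaceInt R 2 c t = ∫ s, K.subtypeL (f s) := rfl
  rw [e, this]
  exact Subtype.mem _

end IsHalfPlaneResolvent

end OperatorSemigroup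

/-! ### Generation and uniqueness of the semigroup -/

namespace OperatorSemigroup

variable {H : Type*} [NormedAddCommGroup H] [InnerProductSpace ℂ H]

namespace IsResolventAt

variable {T : H →ₗ.[ℂ] H} {z w : ℂ} {R R' : H →L[ℂ] H}

lemma mem_graph_iff (h : IsResolventAt T z R) (v w : H) :
    (v, w) ∈ T.graph ↔ R (z • v - w) = v := by
  rw [LinearPMap.mem_graph_iff]
  constructor
  · rintro ⟨y, rfl, rfl⟩
    exact h.2 y
  · intro e
    obtain ⟨hm, he⟩ := h.1 (z • v - w)
    refine ⟨⟨_, hm⟩, e, ?_⟩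
    rw [show z • R (z • v - w) = z • v by rw [e]] at he
    exact sub_right_injective he

lemma apply_mem_graph (h : IsResolventAt T z R) (y : H) : (R y, z • R y - y) ∈ T.graph := by
  rw [h.mem_graph_iff]; simp

lemma sub_eq (h : IsResolventAt T z R) (h' : IsResolventAt T w R') :
    R - R' = (w - z) • (R * R') := by
  ext y
  have := (h.mem_graph_iff _ _).1 (h'.apply_mem_graph y)
  have e : z • R' y - (w • R' y - y) = y - (w - z) • R' y := by rw [sub_smul]; abel
  rw [e, map_sub, map_smul] at this
  simp only [sub_apply, smul_apply, mul_apply_eq_comp]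
  rw [sub_eq_iff_eq_add, ← sub_eq_iff_eq_add']
  exact this

end IsResolventAt

/-- `R` is the resolvent of the densely defined operator `T` on the half-plane `ω < Re z`, where it
decays like `1 / |z|`. -/
structure HasHalfPlaneResolvent (T : H →ₗ.[ℂ] H) (R : ℂ → H →L[ℂ] H) (ω M : ℝ) : Prop where
  dense : Dense (T.domain : Set H)
  pos : 0 < ω
  isResolventAt : ∀ z : ℂ, ω < z.re → IsResolventAt T z (R z)
  norm_le : ∀ z : ℂ, ω < z.re → ‖R z‖ ≤ M / ‖z‖

namespace HasHalfPlaneResolvent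

variable {T : H →ₗ.[ℂ] H} {R : ℂ → H →L[ℂ] H} {ω M : ℝ}

lemma isHalfPlaneResolvent (h : HasHalfPlaneResolvent T R ω M) : IsHalfPlaneResolvent R ω M :=
  ⟨h.pos, fun z w hz hw => (h.isResolventAt z hz).sub_eq (h.isResolventAt w hw), h.norm_le⟩

variable (h : HasHalfPlaneResolvent T R ω M)
include h

lemma exists_hasDerivAt {t : ℝ} (ht : 0 < t) : ∃ D : H →L[ℂ] H,
    HasDerivAt (laplaceSemigroup R ω) D t ∧
    (∀ x, (laplaceSemigroup R ω t x, D x) ∈ T.graph) ∧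
    ∀ x w, (x, w) ∈ T.graph → D x = laplaceSemigroup R ω t w := by
  obtain ⟨D, hD, hμ⟩ := h.isHalfPlaneResolvent.exists_hasDerivAt ht
  have hz : ω < ((ω + 1 : ℝ) : ℂ).re := by simp
  set μ : ℂ := ((ω + 1 : ℝ) : ℂ)
  obtain ⟨e1, e2, e3⟩ := hμ μ hz
  have hr := h.isResolventAt μ hz
  refine ⟨D, hD, fun x => (hr.mem_graph_iff _ _).2 ?_, fun x w hxw => ?_⟩
  · simpa using congrArg (fun f : H →L[ℂ] H => f x) e1
  · have hx := (hr.mem_graph_iff _ _).1 hxw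
    have f1 : R μ (μ • laplaceSemigroup R ω t (μ • x - w) - D (μ • x - w)) =
      laplaceSemigroup R ω t (μ • x - w) := by
      simpa using congrArg (fun f : H →L[ℂ] H => f (μ • x - w)) e1
    have f2 : R μ (D (μ • x - w)) = D (R μ (μ • x - w)) := by
      simpa using congrArg (fun f : H →L[ℂ] H => f (μ • x - w)) e2
    have f3 : R μ (laplaceSemigroup R ω t (μ • x - w)) =
        laplaceSemigroup R ω t (R μ (μ • x - w)) := by
      simpa using congrArg (fun f : H →L[ℂ] H => f (μ • x - w)) e3
    rw [map_sub, map_smul, f3, f2, hx, map_sub, map_smul] at f1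
    exact sub_right_injective f1

lemma exists_norm_le (a : ℝ) :
    ∃ K : ℝ, 0 < K ∧ ∀ t : ℝ, t ≤ a → ‖laplaceSemigroup R ω t‖ ≤ K := by
  refine ⟨max 1 (M ^ 2 * Real.exp (ω * a + 1) / 2), by positivity, fun t ht => ?_⟩
  rcases le_or_gt t 0 with h0 | h0
  · rw [laplaceSemigroup, if_pos h0]
    exact ContinuousLinearMap.norm_id_le.trans (le_max_left _ _)
  · refine (h.isHalfPlaneResolvent.norm_laplaceSemigroup_le h0).trans (le_trans ?_ (le_max_right _ _))
    have := h.pos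
    gcongr

variable [CompleteSpace H]

/-- On the domain, which is the range of $R(\mu)$, this is the norm convergence of $S(t)R(\mu)$.
Density and the uniform bound near $0$ extend it to all vectors. -/
lemma tendsto_zero (x : H) : Tendsto (fun t => laplaceSemigroup R ω t x) (𝓝[>] 0) (𝓝 x) := by
  obtain ⟨K, hK, hb⟩ := h.exists_norm_le 1
  have hz : ω < ((ω + 1 : ℝ) : ℂ).re := by simp
  set μ : ℂ := ((ω + 1 : ℝ) : ℂ)
  have hdom : ∀ y ∈ T.domain, Tendsto (fun t => laplaceSemigroup R ω t y) (𝓝[>] 0) (𝓝 y) := by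
    intro y hy
    have hy' := (h.isResolventAt μ hz).2 ⟨y, hy⟩
    set v := μ • y - T ⟨y, hy⟩
    have := (((ContinuousLinearMap.apply ℂ H v).continuous.tendsto _).comp
      (h.isHalfPlaneResolvent.tendsto_laplaceSemigroup_mul hz))
    simp only [ContinuousLinearMap.apply_apply, Function.comp_def, mul_apply_eq_comp]
      at this
    change R μ v = y at hy'
    simpa only [hy'] using this
  rw [Metric.tendsto_nhds]
  intro ε hε
  obtain ⟨y, hy, hxy⟩ := Metric.mem_closure_iff.1 (h.dense x) (ε / (2 * (K + 1))) (by positivity)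
  have h1 := Metric.tendsto_nhds.1 (hdom y hy) (ε / 2) (by positivity)
  filter_upwards [h1, Ioc_mem_nhdsGT (zero_lt_one' ℝ)] with t ht ht1
  rw [dist_eq_norm] at ht hxy ⊢
  have e : laplaceSemigroup R ω t x - x = laplaceSemigroup R ω t (x - y) - (x - y) +
    (laplaceSemigroup R ω t y - y) := by rw [map_sub]; abel
  have n1 : ‖laplaceSemigroup R ω t (x - y)‖ ≤ K * ‖x - y‖ :=
    ContinuousLinearMap.le_of_opNorm_le _ (hb t ht1.2) _
  calc ‖laplaceSemigroup R ω t x - x‖ ≤ (K * ‖x - y‖ + ‖x - y‖) +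
        ‖laplaceSemigroup R ω t y - y‖ := by
        rw [e]; exact (norm_add_le _ _).trans (by gcongr; exact (norm_sub_le _ _).trans (by gcongr))
    _ < (K + 1) * (ε / (2 * (K + 1))) + ε / 2 := by
        have : (K + 1) * ‖x - y‖ < (K + 1) * (ε / (2 * (K + 1))) := by gcongr
        linarith
    _ = ε := by field_simp; ring

lemma continuousOn_apply (x : H) : ContinuousOn (fun t => laplaceSemigroup R ω t x) (Set.Ici 0) := by
  intro t ht
  rcases eq_or_lt_of_le (show (0 : ℝ) ≤ t from ht) with rfl | h0
  · rw [← continuousWithinAt_Ioi_iff_Ici]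
    have : laplaceSemigroup R ω 0 = 1 := if_pos le_rfl
    simpa [ContinuousWithinAt, this] using h.tendsto_zero x
  · obtain ⟨D, hD, -⟩ := h.exists_hasDerivAt h0
    exact ((ContinuousLinearMap.apply ℂ H x).continuous.continuousAt.comp
      hD.continuousAt).continuousWithinAt

/-- The orbit maps are jointly continuous in time and initial value. -/
lemma tendsto_apply {X : Type*} {l : Filter X} {r : X → ℝ} {v : X → H} {r₀ : ℝ} {v₀ : H}
    (hr : Tendsto r l (𝓝[Set.Ici 0] r₀)) (hr0 : 0 ≤ r₀) (hv : Tendsto v l (𝓝 v₀)) :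
    Tendsto (fun i => laplaceSemigroup R ω (r i) (v i)) l (𝓝 (laplaceSemigroup R ω r₀ v₀)) := by
  obtain ⟨K, hK, hb⟩ := h.exists_norm_le (r₀ + 1)
  have h1 : Tendsto (fun i => laplaceSemigroup R ω (r i) v₀) l (𝓝 (laplaceSemigroup R ω r₀ v₀)) :=
    Tendsto.comp (h.continuousOn_apply v₀ r₀ hr0) hr
  have h2 : Tendsto (fun i => laplaceSemigroup R ω (r i) (v i - v₀)) l (𝓝 0) := by
    have h3 : Tendsto (fun i => K * ‖v i - v₀‖) l (𝓝 0) := by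
      simpa using (tendsto_iff_norm_sub_tendsto_zero.1 hv).const_mul K
    refine squeeze_zero_norm' ?_ h3
    filter_upwards [(tendsto_nhds_of_tendsto_nhdsWithin hr).eventually
      (Iic_mem_nhds (lt_add_one r₀))] with i hi
    exact ContinuousLinearMap.le_of_opNorm_le _ (hb _ hi) _
  simpa using h2.add h1

/-- Uniqueness for $u'=Tu$: the function $s\mapsto S(a-s)u(s)$ has zero right derivative, so its
values at $0$ and $a$ agree. Right derivatives suffice, so the lemma also covers orbits of an
arbitrary semigroup generated by $T$. -/
lemma eq_laplaceSemigroup_apply {u : ℝ → H} {a : ℝ} (ha : 0 ≤ a)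
    (hu : ContinuousOn u (Set.Icc 0 a))
    (hd : ∀ s ∈ Set.Ioo 0 a, ∃ w, HasDerivWithinAt u w (Set.Ioi s) s ∧ (u s, w) ∈ T.graph) :
    u a = laplaceSemigroup R ω a (u 0) := by
  have hS0 : laplaceSemigroup R ω 0 = 1 := if_pos le_rfl
  have hcont : ContinuousOn (fun s => laplaceSemigroup R ω (a - s) (u s)) (Set.Icc 0 a) := by
    intro s hs
    refine h.tendsto_apply ?_ (by linarith [hs.2]) (hu s hs)
    refine tendsto_nhdsWithin_iff.2 ⟨?_, ?_⟩
    · exact ((by fun_prop : Continuous fun s : ℝ => a - s).tendsto s).mono_left nhdsWithin_le_nhds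
    · filter_upwards [self_mem_nhdsWithin] with r hr
      exact sub_nonneg.2 hr.2
  have hder : ∀ s ∈ Set.Ioo 0 a,
      HasDerivWithinAt (fun s => laplaceSemigroup R ω (a - s) (u s)) 0 (Set.Ioi s) s := by
    intro s hs
    obtain ⟨w, hw, hg⟩ := hd s hs
    obtain ⟨D, hD, -, hD2⟩ := h.exists_hasDerivAt (sub_pos.2 hs.2)
    have h1 : HasDerivAt (fun s => (laplaceSemigroup R ω (a - s)).restrictScalars ℝ)
        (-(D.restrictScalars ℝ)) s := by
      have h2 : HasDerivAt (fun s => laplaceSemigroup R ω (a - s)) (-D) s := by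
        simpa using hD.comp_const_sub a s
      exact (ContinuousLinearMap.restrictScalarsL ℂ H H ℝ ℝ).hasFDerivAt.comp_hasDerivAt s h2
    refine (h1.hasDerivWithinAt.clm_apply hw).congr_deriv ?_
    simp [hD2 _ _ hg]
  have := intervalIntegral.integral_eq_sub_of_hasDeriv_right_of_le ha hcont hder
    intervalIntegrable_const
  simp only [intervalIntegral.integral_zero, sub_self, sub_zero, hS0] at this
  exact sub_eq_zero.1 this.symm

lemma isC0Semigroup : IsC0Semigroup (laplaceSemigroup R ω) := by
  have hS0 : laplaceSemigroup R ω 0 = 1 := if_pos le_rfl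
  refine ⟨hS0, fun s t hs ht => ?_, h.tendsto_zero⟩
  rcases eq_or_lt_of_le ht with rfl | ht0
  · rw [add_zero, hS0]; rfl
  ext x
  -- The semigroup law is uniqueness applied to the orbit restarted at time $t$.
  have := h.eq_laplaceSemigroup_apply (u := fun r => laplaceSemigroup R ω (r + t) x) hs ?_ ?_
  · simpa using this
  · refine (h.continuousOn_apply x).comp (by fun_prop) fun r hr => ?_
    exact add_nonneg hr.1 ht
  · intro r hr
    obtain ⟨D, hD, hD1, -⟩ := h.exists_hasDerivAt (add_pos hr.1 ht0)
    refine ⟨D x, HasDerivAt.hasDerivWithinAt ?_, hD1 x⟩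
    exact ((ContinuousLinearMap.apply ℂ H x).restrictScalars ℝ).hasFDerivAt.comp_hasDerivAt r
      (hD.comp_add_const r t)

lemma tendsto_of_mem_graph {x y : H} (hxy : (x, y) ∈ T.graph) :
    Tendsto (fun t : ℝ => ((t⁻¹ : ℝ) : ℂ) • (laplaceSemigroup R ω t x - x)) (𝓝[>] 0) (𝓝 y) := by
  have hS0 : laplaceSemigroup R ω 0 = 1 := if_pos le_rfl
  have hd : ∀ t : ℝ, 0 < t → HasDerivAt (fun t => laplaceSemigroup R ω t x)
      (laplaceSemigroup R ω t y) t := fun t ht => by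
    obtain ⟨D, hD, -, hD2⟩ := h.exists_hasDerivAt ht
    rw [← hD2 x y hxy]
    exact ((ContinuousLinearMap.apply ℂ H x).restrictScalars ℝ).hasFDerivAt.comp_hasDerivAt t hD
  have h1 := hasDerivWithinAt_Ici_of_tendsto_deriv (s := Set.Ioi 0) (a := 0)
    (f := fun t => laplaceSemigroup R ω t x) (e := y)
    (fun t ht => (hd t ht).differentiableAt.differentiableWithinAt)
    ((h.continuousOn_apply x 0 Set.self_mem_Ici).mono Set.Ioi_subset_Ici_self)
    self_mem_nhdsWithin
    ((h.tendsto_zero y).congr' (by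
      filter_upwards [self_mem_nhdsWithin] with t ht using (hd t ht).deriv.symm))
  have h2 := (hasDerivWithinAt_iff_tendsto_slope' (Set.self_notMem_Ioi)).1 h1.Ioi_of_Ici
  refine h2.congr fun t => ?_
  rw [slope_def_module, hS0, sub_zero, Complex.coe_smul]
  rfl

lemma isGenerator : IsGenerator T (laplaceSemigroup R ω) := by
  refine fun x y => ⟨h.tendsto_of_mem_graph, fun hlim => ?_⟩
  have hz : ω < ((ω + 1 : ℝ) : ℂ).re := by simp
  set μ : ℂ := ((ω + 1 : ℝ) : ℂ)
  have hr := h.isResolventAt μ hz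
  have h1 := h.tendsto_of_mem_graph (hr.apply_mem_graph x)
  have h2 := ((R μ).continuous.tendsto y).comp hlim
  -- $R(\mu)$ commutes with the semigroup and maps $x$ into the domain, where the limit of the
  -- difference quotient is already known. The resulting equation puts $(x,y)$ in the graph.
  have e : R μ y = μ • R μ x - x := by
    refine tendsto_nhds_unique (h2.congr' ?_) h1
    filter_upwards [self_mem_nhdsWithin] with t ht
    obtain ⟨D, -, hμ⟩ := h.isHalfPlaneResolvent.exists_hasDerivAt (show 0 < t from ht)
    have f3 : R μ (laplaceSemigroup R ω t x) = laplaceSemigroup R ω t (R μ x) := by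
      simpa using congrArg (fun f : H →L[ℂ] H => f x) (hμ μ hz).2.2
    simp only [Function.comp, map_smul, map_sub, f3]
  rw [hr.mem_graph_iff, map_sub, map_smul, e]
  abel

lemma generates : Generates T := ⟨_, h.isC0Semigroup, h.isGenerator⟩

end HasHalfPlaneResolvent

lemma tendsto_sub_nhdsGT (s : ℝ) : Tendsto (fun t : ℝ => t - s) (𝓝[>] s) (𝓝[>] 0) := by
  refine tendsto_nhdsWithin_iff.2 ⟨?_, ?_⟩
  · simpa using ((by fun_prop : Continuous fun t : ℝ => t - s).tendsto s).mono_left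
      nhdsWithin_le_nhds
  · filter_upwards [self_mem_nhdsWithin] with r hr
    exact sub_pos.2 (show s < r from hr)

/-! ### Orbits of an arbitrary strongly continuous semigroup -/

namespace IsC0Semigroup

variable {S : ℝ → H →L[ℂ] H} (hS : IsC0Semigroup S)
include hS

lemma apply_add {s t : ℝ} (hs : 0 ≤ s) (ht : 0 ≤ t) (x : H) : S (s + t) x = S s (S t x) := by
  rw [hS.add s t hs ht]; rfl

variable [CompleteSpace H]

/-- Otherwise some sequence $t_n\downarrow0$ has unbounded norms although every orbit converges
along it, against Banach–Steinhaus. -/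
lemma exists_norm_le : ∃ δ > 0, ∃ K : ℝ, ∀ t : ℝ, 0 ≤ t → t ≤ δ → ‖S t‖ ≤ K := by
  by_contra! hcon
  have hex : ∀ n : ℕ, ∃ t : ℝ, 0 < t ∧ t ≤ 1 / ((n : ℝ) + 1) ∧ (n : ℝ) + 1 < ‖S t‖ := fun n => by
    obtain ⟨t, ht0, ht1, ht⟩ := hcon (1 / ((n : ℝ) + 1)) (by positivity) ((n : ℝ) + 1)
    refine ⟨t, lt_of_le_of_ne ht0 ?_, ht1, ht⟩
    rintro rfl
    rw [hS.zero] at ht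
    have := ContinuousLinearMap.norm_id_le (𝕜 := ℂ) (E := H)
    have : (0 : ℝ) ≤ n := n.cast_nonneg
    linarith
  choose t ht0 ht1 ht using hex
  have hlim : Tendsto t atTop (𝓝[>] 0) := tendsto_nhdsWithin_iff.2
    ⟨squeeze_zero (fun n => (ht0 n).le) ht1 tendsto_one_div_add_atTop_nhds_zero_nat,
      Eventually.of_forall ht0⟩
  obtain ⟨C, hC⟩ := banach_steinhaus (g := fun n => S (t n)) fun x => by
    obtain ⟨C, hC⟩ := (Metric.isBounded_range_of_tendsto _
      ((hS.tendsto x).comp hlim)).exists_norm_le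
    exact ⟨C, fun n => hC _ ⟨n, rfl⟩⟩
  obtain ⟨n, hn⟩ := exists_nat_gt C
  have := hC n
  have := ht n
  linarith

omit [CompleteSpace H] in
lemma continuousWithinAt_Ioi {s : ℝ} (hs : 0 ≤ s) (x : H) :
    ContinuousWithinAt (fun t => S t x) (Set.Ioi s) s := by
  have h1 := tendsto_sub_nhdsGT s
  have h2 := ((S s).continuous.tendsto x).comp ((hS.tendsto x).comp h1)
  refine h2.congr' ?_
  filter_upwards [self_mem_nhdsWithin] with r hr
  simp only [Function.comp]
  rw [← hS.apply_add hs (sub_nonneg.2 (le_of_lt hr)), add_sub_cancel]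

/-- $S(s)x-S(t)x=S(t)(S(s-t)x-x)$, so a bound on $S(t)$ for $t$ near $s$ is needed. It comes from
$S(t)=S(t-a)S(a)$ with $a$ within $\delta$ of $s$. -/
lemma continuousWithinAt_Iio {s : ℝ} (hs : 0 < s) (x : H) :
    ContinuousWithinAt (fun t => S t x) (Set.Iio s) s := by
  obtain ⟨δ, hδ, K, hK⟩ := hS.exists_norm_le
  set a := max 0 (s - δ) with ha
  have ha0 : 0 ≤ a := le_max_left _ _
  have has : a < s := max_lt hs (by linarith)
  have h1 : Tendsto (fun t : ℝ => s - t) (𝓝[<] s) (𝓝[>] 0) := by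
    refine tendsto_nhdsWithin_iff.2 ⟨?_, ?_⟩
    · simpa using ((by fun_prop : Continuous fun t : ℝ => s - t).tendsto s).mono_left
        nhdsWithin_le_nhds
    · filter_upwards [self_mem_nhdsWithin] with r hr
      exact sub_pos.2 (show r < s from hr)
  have h2 : Tendsto (fun t : ℝ => K * ‖S a‖ * ‖S (s - t) x - x‖) (𝓝[<] s) (𝓝 0) := by
    simpa using (tendsto_iff_norm_sub_tendsto_zero.1 ((hS.tendsto x).comp h1)).const_mul (K * ‖S a‖)
  refine tendsto_iff_norm_sub_tendsto_zero.2
    (squeeze_zero' (Eventually.of_forall fun _ => norm_nonneg _) ?_ h2)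
  filter_upwards [Ioo_mem_nhdsLT has] with t ht
  have ht0 : 0 ≤ t := ha0.trans ht.1.le
  have e1 : S s x = S t (S (s - t) x) := by
    rw [← hS.apply_add ht0 (sub_nonneg.2 ht.2.le), add_sub_cancel]
  have e2 : S t (x - S (s - t) x) = S (t - a) (S a (x - S (s - t) x)) := by
    rw [← hS.apply_add (sub_nonneg.2 ht.1.le) ha0, sub_add_cancel]
  rw [e1, ← map_sub, e2, mul_assoc]
  have h3 : t - a ≤ δ := by have := le_max_right 0 (s - δ); linarith [ht.2]
  refine (ContinuousLinearMap.le_of_opNorm_le _ (hK _ (sub_nonneg.2 ht.1.le) h3) _).trans ?_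
  have hK0 : 0 ≤ K := (norm_nonneg _).trans (hK 0 le_rfl hδ.le)
  rw [norm_sub_rev]
  gcongr
  exact (S a).le_opNorm _

lemma continuousOn_apply (x : H) : ContinuousOn (fun t => S t x) (Set.Ici 0) := by
  intro s hs
  rcases eq_or_lt_of_le (show (0 : ℝ) ≤ s from hs) with rfl | h0
  · rw [← continuousWithinAt_Ioi_iff_Ici]
    exact hS.continuousWithinAt_Ioi le_rfl x
  · exact (continuousAt_iff_continuous_left'_right'.2
      ⟨hS.continuousWithinAt_Iio h0 x, hS.continuousWithinAt_Ioi h0.le x⟩).continuousWithinAt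

omit [CompleteSpace H] in
lemma hasDerivWithinAt {T : H →ₗ.[ℂ] H} (hT : IsGenerator T S) {x y : H} (hxy : (x, y) ∈ T.graph)
    {s : ℝ} (hs : 0 ≤ s) :
    HasDerivWithinAt (fun t => S t x) (S s y) (Set.Ioi s) s ∧ (S s x, S s y) ∈ T.graph := by
  have key : Tendsto (fun t : ℝ => ((t⁻¹ : ℝ) : ℂ) • (S (s + t) x - S s x)) (𝓝[>] 0)
      (𝓝 (S s y)) := by
    refine (((S s).continuous.tendsto y).comp ((hT x y).1 hxy)).congr' ?_
    filter_upwards [self_mem_nhdsWithin] with t ht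
    simp only [Function.comp, map_smul, map_sub]
    rw [hS.apply_add hs (le_of_lt ht)]
  constructor
  · rw [hasDerivWithinAt_iff_tendsto_slope' (Set.self_notMem_Ioi)]
    have h1 := tendsto_sub_nhdsGT s
    refine (key.comp h1).congr fun t => ?_
    rw [slope_def_module, Function.comp, Complex.coe_smul, add_sub_cancel]
  · refine (hT _ _).2 (key.congr' ?_)
    filter_upwards [self_mem_nhdsWithin] with t ht
    rw [add_comm, hS.apply_add (le_of_lt ht) hs]

end IsC0Semigroup

namespace HasHalfPlaneResolvent

variable {T : H →ₗ.[ℂ] H} {R : ℂ → H →L[ℂ] H} {ω M : ℝ} [CompleteSpace H]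

lemma eq_laplaceSemigroup (h : HasHalfPlaneResolvent T R ω M) {S : ℝ → H →L[ℂ] H}
    (hS : IsC0Semigroup S) (hT : IsGenerator T S) {t : ℝ} (ht : 0 ≤ t) :
    S t = laplaceSemigroup R ω t := by
  refine ContinuousLinearMap.ext_on (s := (T.domain : Set H)) ?_ fun x hx => ?_
  · exact h.dense.mono Submodule.subset_span
  · have := h.eq_laplaceSemigroup_apply (u := fun r => S r x) ht
      ((hS.continuousOn_apply x).mono Set.Icc_subset_Ici_self)
      fun s hs => ⟨_, hS.hasDerivWithinAt hT (T.mem_graph ⟨x, hx⟩) hs.1.le⟩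
    simpa [hS.zero] using this

lemma expSemigroup_eq (h : HasHalfPlaneResolvent T R ω M) {t : ℝ} (ht : 0 ≤ t) :
    expSemigroup T t = laplaceSemigroup R ω t := by
  rw [expSemigroup, dif_pos h.generates]
  exact h.eq_laplaceSemigroup h.generates.choose_spec.1 h.generates.choose_spec.2 ht

end HasHalfPlaneResolvent

end OperatorSemigroup

/-! ### Resolvents of negative self-adjoint operators and of their perturbations -/

namespace OperatorSemigroup

variable {H : Type*} [NormedAddCommGroup H] [InnerProductSpace ℂ H] [CompleteSpace H]

section negative

variable {T₀ : H →ₗ.[ℂ] H} (hsa : IsSelfAdjoint T₀) (hneg : IsNegative T₀)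
include hsa

lemma inner_eq_of_mem_graph {x v y w : H} (hx : (x, v) ∈ T₀.graph) (hy : (y, w) ∈ T₀.graph) :
    inner ℂ v y = inner ℂ x w := by
  have h := LinearPMap.adjoint_isFormalAdjoint hsa.dense_domain
  rw [LinearPMap.isSelfAdjoint_def.1 hsa] at h
  obtain ⟨x, rfl, rfl⟩ := T₀.mem_graph_iff.1 hx
  obtain ⟨y, rfl, rfl⟩ := T₀.mem_graph_iff.1 hy
  exact h x y

lemma mem_graph_of_inner_eq {y w : H} (h : ∀ x v, (x, v) ∈ T₀.graph → inner ℂ w x = inner ℂ y v) :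
    (y, w) ∈ T₀.graph := by
  have h' : ∀ x : T₀.domain, inner ℂ w (x : H) = inner ℂ y (T₀ x) :=
    fun x => h _ _ (T₀.mem_graph x)
  have hm := T₀.mem_adjoint_domain_of_exists y ⟨w, h'⟩
  have := LinearPMap.adjoint_apply_eq hsa.dense_domain ⟨y, hm⟩ h'
  have hg : (y, w) ∈ T₀.adjoint.graph := (LinearPMap.mem_graph_iff _).2 ⟨⟨y, hm⟩, rfl, this⟩
  rwa [LinearPMap.isSelfAdjoint_def.1 hsa] at hg

include hneg

/-- Symmetry makes $\langle x,v\rangle$ real and negativity makes it nonpositive, so the cross term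
$-2\kappa\,\mathrm{Re}\,z\,\langle x,v\rangle$ in the expanded square is nonnegative. -/
lemma norm_sq_add_norm_sq_le {κ : ℝ} (hκ : 0 ≤ κ) {z : ℂ} (hz : 0 ≤ z.re) {x v : H}
    (hx : (x, v) ∈ T₀.graph) :
    (‖z‖ * ‖x‖) ^ 2 + (κ * ‖v‖) ^ 2 ≤ ‖z • x - (κ : ℂ) • v‖ ^ 2 := by
  have h1 : (inner ℂ x v).re ≤ 0 := by
    obtain ⟨y, rfl, rfl⟩ := T₀.mem_graph_iff.1 hx
    have := hneg y
    rwa [← inner_conj_symm, Complex.conj_re] at this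
  have h2 : (inner ℂ x v).im = 0 := by
    have := inner_eq_of_mem_graph hsa hx hx
    rw [← inner_conj_symm] at this
    exact Complex.conj_eq_iff_im.1 this
  rw [@norm_sub_sq ℂ, norm_smul, norm_smul, inner_smul_left, inner_smul_right]
  have h3 : RCLike.re ((starRingEnd ℂ) z * ((κ : ℂ) * inner ℂ x v)) =
      κ * (z.re * (inner ℂ x v).re) := by
    simp [h2]; ring
  rw [h3, Complex.norm_real, Real.norm_eq_abs, abs_of_nonneg hκ]
  have : κ * (z.re * (inner ℂ x v).re) ≤ 0 :=
    mul_nonpos_of_nonneg_of_nonpos hκ (mul_nonpos_of_nonneg_of_nonpos hz h1)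
  linarith

lemma norm_mul_norm_le {κ : ℝ} (hκ : 0 ≤ κ) {z : ℂ} (hz : 0 ≤ z.re) {x v : H}
    (hx : (x, v) ∈ T₀.graph) :
    ‖z‖ * ‖x‖ ≤ ‖z • x - (κ : ℂ) • v‖ ∧ κ * ‖v‖ ≤ ‖z • x - (κ : ℂ) • v‖ := by
  have h := norm_sq_add_norm_sq_le hsa hneg hκ hz hx
  constructor <;> refine le_of_sq_le_sq ?_ (norm_nonneg _)
  · nlinarith [sq_nonneg (κ * ‖v‖)]
  · nlinarith [sq_nonneg (‖z‖ * ‖x‖)]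

/-- On the closed graph, $z-\kappa T_0$ is bounded below, hence injective with closed range. A
vector orthogonal to the range lies in the domain of the adjoint, which is $T_0$, and satisfies
$\kappa T_0y=\bar zy$, so the same lower bound at $\bar z$ kills it. -/
lemma exists_resolvent_of_isNegative {κ : ℝ} (hκ : 0 < κ) {z : ℂ} (hz : 0 < z.re) :
    ∃ R V : H →L[ℂ] H, ∀ y, (R y, V y) ∈ T₀.graph ∧ z • R y - (κ : ℂ) • V y = y := by
  have hz0 : 0 < ‖z‖ := hz.trans_le (Complex.re_le_norm z)
  have hκ' : (κ : ℂ) ≠ 0 := by exact_mod_cast hκ.ne'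
  have hcl : IsClosed (T₀.graph : Set (H × H)) := hsa.isClosed
  have : CompleteSpace T₀.graph := hcl.completeSpace_coe
  let f : T₀.graph →L[ℂ] H :=
    (z • ContinuousLinearMap.fst ℂ H H - (κ : ℂ) • ContinuousLinearMap.snd ℂ H H).comp
      T₀.graph.subtypeL
  have hf : ∀ g : T₀.graph, f g = z • (g : H × H).1 - (κ : ℂ) • (g : H × H).2 := fun g => rfl
  have hb : ∀ g : T₀.graph, ‖g‖ ≤ max (1 / ‖z‖) (1 / κ) * ‖f g‖ := fun g => by
    have := norm_mul_norm_le hsa hneg hκ.le hz.le g.2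
    rw [← hf] at this
    change ‖(g : H × H)‖ ≤ _
    rw [Prod.norm_def]
    refine max_le ?_ ?_
    · calc ‖(g : H × H).1‖ ≤ 1 / ‖z‖ * ‖f g‖ := by
            rw [one_div, ← div_eq_inv_mul, le_div_iff₀ hz0, mul_comm]; exact this.1
        _ ≤ _ := by gcongr; exact le_max_left _ _
    · calc ‖(g : H × H).2‖ ≤ 1 / κ * ‖f g‖ := by
            rw [one_div, ← div_eq_inv_mul, le_div_iff₀ hκ, mul_comm]; exact this.2
        _ ≤ _ := by gcongr; exact le_max_right _ _
  have hal : AntilipschitzWith (Real.toNNReal (max (1 / ‖z‖) (1 / κ))) f := by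
    refine f.antilipschitz_of_bound fun g => ?_
    rw [Real.coe_toNNReal _ (by positivity)]
    exact hb g
  have hclr : IsClosed (f.range : Set H) := hal.isClosed_range f.uniformContinuous
  have hrange : f.range = ⊤ := by
    have : CompleteSpace f.range := hclr.completeSpace_coe
    rw [← Submodule.orthogonal_eq_bot_iff, Submodule.eq_bot_iff]
    intro y hy
    have horth : ∀ x v, (x, v) ∈ T₀.graph → z * inner ℂ y x = κ * inner ℂ y v := fun x v hxv => by
      have h1 := (Submodule.mem_orthogonal' _ _).1 hy (f ⟨_, hxv⟩) ⟨_, rfl⟩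
      rwa [hf, inner_sub_right, inner_smul_right, inner_smul_right, sub_eq_zero] at h1
    have hg : (y, ((κ : ℂ)⁻¹ * (starRingEnd ℂ) z) • y) ∈ T₀.graph := by
      refine mem_graph_of_inner_eq hsa fun x v hxv => ?_
      have := horth x v hxv
      rw [inner_smul_left]
      simp only [map_mul, map_inv₀, Complex.conj_ofReal, Complex.conj_conj]
      rw [mul_assoc, this, inv_mul_cancel_left₀ hκ']
    have h2 := (norm_mul_norm_le hsa hneg hκ.le (z := (starRingEnd ℂ) z)
      (by simpa using hz.le) hg).1
    rw [smul_smul, mul_inv_cancel_left₀ hκ', sub_self, norm_zero, Complex.norm_conj] at h2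
    have : ‖y‖ ≤ 0 := nonpos_of_mul_nonpos_right h2 hz0
    simpa using this
  let e : T₀.graph ≃L[ℂ] H := ContinuousLinearEquiv.ofBijective f
    (LinearMap.ker_eq_bot.2 hal.injective) hrange
  have he : ∀ y, f (e.symm y) = y := fun y => e.apply_symm_apply y
  refine ⟨(ContinuousLinearMap.fst ℂ H H).comp (T₀.graph.subtypeL.comp (e.symm : H →L[ℂ] T₀.graph)),
    (ContinuousLinearMap.snd ℂ H H).comp (T₀.graph.subtypeL.comp (e.symm : H →L[ℂ] T₀.graph)),
    fun y => ⟨(e.symm y).2, ?_⟩⟩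
  have := he y
  rwa [hf] at this

end negative

omit [CompleteSpace H] in
lemma family_domain (T₀ T₁ : H →ₗ.[ℂ] H) (κ : ℝ) :
    (family T₀ T₁ κ).domain = T₀.domain ⊓ T₁.domain := rfl

omit [CompleteSpace H] in
lemma family_apply (T₀ T₁ : H →ₗ.[ℂ] H) (κ : ℝ) {x : H} (hx : x ∈ (family T₀ T₁ κ).domain)
    (h₀ : x ∈ T₀.domain) (h₁ : x ∈ T₁.domain) :
    family T₀ T₁ κ ⟨x, hx⟩ = (κ : ℂ) • T₀ ⟨x, h₀⟩ + T₁ ⟨x, h₁⟩ := rfl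

section perturbation

variable {T₀ T₁ : H →ₗ.[ℂ] H} (hsa : IsSelfAdjoint T₀) (hneg : IsNegative T₀)
  (hrel : IsInfinitesimallyBounded T₀ T₁)
include hsa hneg hrel

lemma exists_resolvent_family : ∃ ω > (0 : ℝ), ∀ κ : ℝ, 1 / 2 ≤ κ → ∀ z : ℂ, ω < z.re →
    ∃ R V : H →L[ℂ] H, IsResolventAt (family T₀ T₁ κ) z R ∧ ‖R‖ ≤ 2 / ‖z‖ ∧ ‖V‖ ≤ 4 ∧
      ∀ y, (R y, V y) ∈ T₀.graph := by
  obtain ⟨hdom, C, -, hC⟩ := hrel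
  -- As $\kappa\ge1/2$ gives $\|T_0(z-\kappa T_0)^{-1}\|\le2$, the relative bound $1/8$ contributes
  -- $1/4$. The condition $|z|\ge4|C(1/8)|$ contributes another $1/4$, so $B=T_1(z-\kappa T_0)^{-1}$
  -- has norm at most $1/2$ and $1-B$ is invertible.
  refine ⟨4 * |C (1 / 8)| + 1, by positivity, fun κ hκ z hz => ?_⟩
  have hκ0 : 0 < κ := by linarith
  have hz1 : 0 < z.re := lt_trans (by positivity) hz
  have hz0 : 0 < ‖z‖ := hz1.trans_le (Complex.re_le_norm z)
  have hzC : 4 * |C (1 / 8)| ≤ ‖z‖ := by have := Complex.re_le_norm z; linarith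
  obtain ⟨R, V, hRV⟩ := exists_resolvent_of_isNegative hsa hneg hκ0 hz1
  have hdomR : ∀ y, R y ∈ T₀.domain := fun y => LinearPMap.mem_domain_of_mem_graph (hRV y).1
  have hVR : ∀ y, T₀ ⟨R y, hdomR y⟩ = V y := fun y =>
    ((LinearPMap.mem_graph_iff' _).1 (hRV y).1).elim fun w hw => by
      have h1 := congrArg Prod.fst hw
      have h2 := congrArg Prod.snd hw
      simp only at h1 h2
      rw [← h2]
      congr 1
      exact Subtype.ext h1.symm
  have hRle : ∀ y, ‖z‖ * ‖R y‖ ≤ ‖y‖ := fun y => by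
    have := (norm_mul_norm_le hsa hneg hκ0.le hz1.le (hRV y).1).1
    rwa [(hRV y).2] at this
  have hVle : ∀ y, κ * ‖V y‖ ≤ ‖y‖ := fun y => by
    have := (norm_mul_norm_le hsa hneg hκ0.le hz1.le (hRV y).1).2
    rwa [(hRV y).2] at this
  have hVle2 : ∀ y, ‖V y‖ ≤ 2 * ‖y‖ := fun y => by nlinarith [hVle y, norm_nonneg (V y)]
  let Bl : H →ₗ[ℂ] H := T₁.toFun.comp
    ((R : H →ₗ[ℂ] H).codRestrict T₁.domain fun y => hdom (hdomR y))
  have hBl : ∀ y, Bl y = T₁ ⟨R y, hdom (hdomR y)⟩ := fun y => rfl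
  have hBle : ∀ y, ‖Bl y‖ ≤ 1 / 2 * ‖y‖ := fun y => by
    have h1 := hC (1 / 8) (by norm_num) (R y) (hdomR y) (hdom (hdomR y))
    rw [hVR] at h1
    have h2 : C (1 / 8) * ‖R y‖ ≤ 1 / 4 * ‖y‖ := by
      calc C (1 / 8) * ‖R y‖ ≤ |C (1 / 8)| * ‖R y‖ := by gcongr; exact le_abs_self _
        _ ≤ (‖z‖ / 4) * ‖R y‖ := by gcongr; linarith
        _ ≤ _ := by linarith [hRle y]
    rw [hBl]
    linarith [hVle2 y]
  let B : H →L[ℂ] H := Bl.mkContinuous (1 / 2) hBle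
  have hB : ∀ y, B y = T₁ ⟨R y, hdom (hdomR y)⟩ := fun y => rfl
  have hBnorm : ‖B‖ < 1 := (Bl.mkContinuous_norm_le (by norm_num) hBle).trans_lt (by norm_num)
  have hBle' : ∀ y, ‖B y‖ ≤ 1 / 2 * ‖y‖ := hBle
  obtain ⟨N, hN⟩ : ∃ N : H →L[ℂ] H, (1 - B) * N = 1 :=
    ⟨((Units.oneSub B hBnorm)⁻¹ : (H →L[ℂ] H)ˣ), (Units.oneSub B hBnorm).mul_inv⟩
  have hNy : ∀ y, N y - B (N y) = y := fun y => by
    simpa using congrArg (fun f : H →L[ℂ] H => f y) hN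
  have hNle : ∀ y, ‖N y‖ ≤ 2 * ‖y‖ := fun y => by
    have h1 : ‖N y‖ ≤ ‖N y - B (N y)‖ + ‖B (N y)‖ := by
      simpa using norm_add_le (N y - B (N y)) (B (N y))
    rw [hNy] at h1
    linarith [hBle' (N y)]
  -- For $w$ in the kernel, $u=(z-\kappa T_0)w$ satisfies $Bu=u$, which is impossible for $u\ne0$.
  have hker : ∀ w (hw : w ∈ (family T₀ T₁ κ).domain), z • w - family T₀ T₁ κ ⟨w, hw⟩ = 0 →
      w = 0 := by
    intro w hw h0
    have hw0 : w ∈ T₀.domain := hw.1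
    set u := z • w - (κ : ℂ) • T₀ ⟨w, hw0⟩ with hu
    have hRu : R u = w := by
      have h1 : (R u - w, V u - T₀ ⟨w, hw0⟩) ∈ T₀.graph :=
        T₀.graph.sub_mem (hRV u).1 (T₀.mem_graph ⟨w, hw0⟩)
      have h2 := (norm_mul_norm_le hsa hneg hκ0.le hz1.le h1).1
      have h3 : z • (R u - w) - (κ : ℂ) • (V u - T₀ ⟨w, hw0⟩) =
          (z • R u - (κ : ℂ) • V u) - u := by rw [hu, smul_sub, smul_sub]; abel
      rw [h3, (hRV u).2, sub_self, norm_zero] at h2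
      have : ‖R u - w‖ ≤ 0 := nonpos_of_mul_nonpos_right h2 hz0
      exact sub_eq_zero.1 (norm_le_zero_iff.1 this)
    have hBu : B u = u := by
      rw [hB]
      rw [family_apply T₀ T₁ κ hw hw0 hw.2, ← sub_sub, sub_eq_zero] at h0
      rw [hu, h0]
      congr 1
      exact Subtype.ext (by rw [← h0]; exact hRu)
    have := hBle' u
    rw [hBu] at this
    have hu0 : u = 0 := by
      rw [← norm_le_zero_iff]; linarith
    rw [← hRu, hu0, map_zero]
  have hdomF : ∀ y, R (N y) ∈ (family T₀ T₁ κ).domain := fun y => ⟨hdomR _, hdom (hdomR _)⟩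
  have hright : ∀ y, z • R (N y) - family T₀ T₁ κ ⟨R (N y), hdomF y⟩ = y := fun y => by
    rw [family_apply T₀ T₁ κ (hdomF y) (hdomR _) (hdom (hdomR _)), hVR, ← hB, ← sub_sub,
      (hRV (N y)).2, hNy]
  refine ⟨R.comp N, V.comp N, ⟨fun y => ⟨hdomF y, hright y⟩, fun x => ?_⟩, ?_, ?_,
    fun y => (hRV (N y)).1⟩
  · set y := z • (x : H) - family T₀ T₁ κ x with hy
    have h1 := hright y
    have h2 := hker (R (N y) - x) ((family T₀ T₁ κ).domain.sub_mem (hdomF y) x.2) (by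
      have e : (⟨R (N y) - x, (family T₀ T₁ κ).domain.sub_mem (hdomF y) x.2⟩ :
        (family T₀ T₁ κ).domain) = ⟨R (N y), hdomF y⟩ - x := rfl
      rw [e, LinearPMap.map_sub, smul_sub]
      calc _ = (z • R (N y) - family T₀ T₁ κ ⟨R (N y), hdomF y⟩) -
            (z • (x : H) - family T₀ T₁ κ x) := by abel
        _ = 0 := by rw [h1, ← hy, sub_self])
    exact sub_eq_zero.1 h2
  · refine ContinuousLinearMap.opNorm_le_bound _ (by positivity) fun y => ?_
    rw [div_mul_eq_mul_div, le_div_iff₀ hz0, mul_comm]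
    exact (hRle (N y)).trans (hNle y)
  · refine ContinuousLinearMap.opNorm_le_bound _ (by positivity) fun y => ?_
    have := hVle2 (N y)
    have := hNle y
    change ‖V (N y)‖ ≤ _
    linarith

theorem exists_halfPlaneResolvent_family (hcomp : HasCompactResolvent T₀) :
    ∃ (ω : ℝ) (R : ℝ → ℂ → H →L[ℂ] H),
      (∀ κ : ℝ, 1 / 2 ≤ κ → HasHalfPlaneResolvent (family T₀ T₁ κ) (R κ) ω 2) ∧
      (∀ κ : ℝ, 1 / 2 ≤ κ → ∀ z : ℂ, ω < z.re → ‖R κ z - R 1 z‖ ≤ 8 * |1 - κ| / ‖z‖) ∧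
      ∀ κ : ℝ, 1 / 2 ≤ κ → ∀ z : ℂ, ω < z.re → IsCompactOperator (R κ z) := by
  obtain ⟨ω, hω, h⟩ := exists_resolvent_family hsa hneg hrel
  choose! R V hR hRn hVn hg using h
  have hdom : ∀ κ : ℝ, (family T₀ T₁ κ).domain = T₀.domain := fun κ =>
    (family_domain T₀ T₁ κ).trans (inf_eq_left.2 hrel.1)
  refine ⟨ω, R, fun κ hκ => ⟨?_, hω, hR κ hκ, hRn κ hκ⟩, fun κ hκ z hz => ?_, fun κ hκ z hz => ?_⟩
  · rw [hdom]; exact hsa.dense_domain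
  · have h1 : (1 : ℝ) / 2 ≤ 1 := by norm_num
    -- Second resolvent identity: $T(\kappa)-T(1)=(\kappa-1)T_0$, and `V 1 z` is $T_0R_1(z)$.
    have e : R κ z - R 1 z = ((κ : ℂ) - 1) • (R κ z).comp (V 1 z) := by
      ext y
      have hm : R 1 z y ∈ T₀.domain := LinearPMap.mem_domain_of_mem_graph (hg 1 h1 z hz y)
      have hV : T₀ ⟨R 1 z y, hm⟩ = V 1 z y := by
        obtain ⟨w, hw1, hw2⟩ := T₀.mem_graph_iff.1 (hg 1 h1 z hz y)
        simp only at hw1 hw2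
        rw [← hw2]
        congr 1
        exact Subtype.ext hw1.symm
      obtain ⟨hm1, e1⟩ := (hR 1 h1 z hz).1 y
      have e2 := (hR κ hκ z hz).2 ⟨R 1 z y, (hdom κ).symm ▸ hm⟩
      rw [family_apply T₀ T₁ 1 hm1 hm (hrel.1 hm), hV] at e1
      rw [family_apply T₀ T₁ κ _ hm (hrel.1 hm), hV] at e2
      have e3 : z • R 1 z y - ((κ : ℂ) • V 1 z y + T₁ ⟨R 1 z y, hrel.1 hm⟩) =
          y - ((κ : ℂ) - 1) • V 1 z y := by
        calc _ = (z • R 1 z y - (((1 : ℝ) : ℂ) • V 1 z y + T₁ ⟨R 1 z y, hrel.1 hm⟩)) -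
              ((κ : ℂ) - 1) • V 1 z y := by
              rw [Complex.ofReal_one, one_smul, sub_smul, one_smul]
              abel
          _ = _ := by rw [e1]
      simp only at e2
      rw [e3, map_sub, map_smul] at e2
      simp only [sub_apply, smul_apply, ContinuousLinearMap.comp_apply]
      rw [← e2]; abel
    rw [e, norm_smul]
    have n1 : ‖(κ : ℂ) - 1‖ = |1 - κ| := by
      rw [abs_sub_comm, ← Real.norm_eq_abs, ← Complex.norm_real]; simp
    have n2 : ‖(R κ z).comp (V 1 z)‖ ≤ 2 / ‖z‖ * 4 :=
      (ContinuousLinearMap.opNorm_comp_le _ _).trans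
        (mul_le_mul (hRn κ hκ z hz) (hVn 1 h1 z hz) (norm_nonneg _) (by positivity))
    rw [n1]
    calc |1 - κ| * ‖(R κ z).comp (V 1 z)‖ ≤ |1 - κ| * (2 / ‖z‖ * 4) := by gcongr
      _ = _ := by ring
  · obtain ⟨z₀, R₀, hR₀, hc⟩ := hcomp
    -- `V κ z` is $T_0R_\kappa(z)$, so the resolvent of the family factors through the compact
    -- resolvent of $T_0$.
    have e : R κ z = R₀.comp (z₀ • R κ z - V κ z) := by
      ext y
      exact ((hR₀.mem_graph_iff _ _).1 (hg κ hκ z hz y)).symm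
    rw [e]
    exact hc.comp_clm _

end perturbation

end OperatorSemigroup

/-! ### Spectral gaps of compact operators and Riesz projections -/

namespace OperatorSemigroup

section eigenvalues

variable {H : Type*} [NormedAddCommGroup H] [InnerProductSpace ℂ H]

open InnerProductSpace in
/-- A compact operator has finitely many eigenvalues away from zero. -/
lemma finite_setOf_hasEigenvalue_le_norm {A : H →L[ℂ] H} (hA : IsCompactOperator A) {ε : ℝ}
    (hε : 0 < ε) :
    {z : ℂ | Module.End.HasEigenvalue (A : Module.End ℂ H) z ∧ ε ≤ ‖z‖}.Finite := by
  by_contra hinf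
  let f := Set.Infinite.natEmbedding _ hinf
  have hfi : Function.Injective fun n => (f n : ℂ) := Subtype.val_injective.comp f.injective
  choose v hv using fun n => (f n).2.1.exists_hasEigenvector
  have hli := Module.End.eigenvectors_linearIndependent' (A : Module.End ℂ H) _ hfi v hv
  have hAv : ∀ n, A (v n) = (f n : ℂ) • v n := fun n => (hv n).apply_eq_smul
  -- $A$ is triangular in this orthonormal system with the eigenvalues on the diagonal, so for $m<n$
  -- the component of $Ae_n-Ae_m$ along $e_n$ has modulus at least $\varepsilon$. No subsequence of
  -- $Ae_n$ is then Cauchy.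
  set e := gramSchmidtNormed ℂ v with he
  have hon : Orthonormal ℂ e := gramSchmidtNormed_orthonormal hli
  have hmem : ∀ n, e n ∈ Submodule.span ℂ (v '' Set.Iic n) := fun n =>
    Submodule.smul_mem _ _ (gramSchmidt_mem_span ℂ v le_rfl)
  have hort : ∀ n, ∀ x ∈ Submodule.span ℂ (v '' Set.Iio n), inner ℂ (e n) x = 0 := by
    intro n x hx
    induction hx using Submodule.span_induction with
    | mem x hx =>
      obtain ⟨i, hi, rfl⟩ := hx
      rw [he, gramSchmidtNormed, inner_smul_left, gramSchmidt_inv_triangular ℂ v hi, mul_zero]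
    | zero => simp
    | add x y _ _ hx hy => rw [inner_add_right, hx, hy, add_zero]
    | smul a x _ hx => rw [inner_smul_right, hx, mul_zero]
  have hlow : ∀ n, ∀ x ∈ Submodule.span ℂ (v '' Set.Iic n),
      A x - (f n : ℂ) • x ∈ Submodule.span ℂ (v '' Set.Iio n) := by
    intro n x hx
    induction hx using Submodule.span_induction with
    | mem x hx =>
      obtain ⟨i, hi, rfl⟩ := hx
      rw [hAv, ← sub_smul]
      rcases eq_or_lt_of_le (show i ≤ n from hi) with rfl | hlt
      · simp
      · exact Submodule.smul_mem _ _ (Submodule.subset_span ⟨i, hlt, rfl⟩)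
    | zero => simp
    | add x y _ _ hx hy =>
      have := Submodule.add_mem _ hx hy
      rwa [sub_add_sub_comm, ← map_add, ← smul_add] at this
    | smul a x _ hx =>
      have := Submodule.smul_mem _ a hx
      rwa [smul_sub, ← map_smul, smul_comm] at this
  have hd : ∀ n, inner ℂ (e n) (A (e n)) = f n := fun n => by
    have h1 := hort n _ (hlow n _ (hmem n))
    rw [inner_sub_right, inner_smul_right, sub_eq_zero] at h1
    rw [h1, inner_self_eq_norm_sq_to_K, hon.1 n]
    simp
  have hoff : ∀ m n, m < n → inner ℂ (e n) (A (e m)) = 0 := fun m n hmn => by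
    have h1 := hort n _ (Submodule.span_mono (Set.image_mono
      (Set.Iio_subset_Iio hmn.le)) (hlow m _ (hmem m)))
    rw [inner_sub_right, inner_smul_right, hon.2 hmn.ne', mul_zero, sub_zero] at h1
    exact h1
  have hsep : ∀ m n, m < n → ε ≤ dist (A (e n)) (A (e m)) := fun m n hmn => by
    have h1 := norm_inner_le_norm (𝕜 := ℂ) (e n) (A (e n) - A (e m))
    rw [inner_sub_right, hd, hoff m n hmn, sub_zero, hon.1 n, one_mul] at h1
    rw [dist_eq_norm]
    exact (f n).2.2.trans h1
  have hK := hA.isCompact_closure_image_closedBall (f := (A : H →ₗ[ℂ] H)) 1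
  obtain ⟨a, -, φ, hφ, hlim⟩ := hK.tendsto_subseq (x := fun n => A (e n)) fun n =>
    subset_closure ⟨e n, by simp [hon.1 n], rfl⟩
  obtain ⟨N, hN⟩ := Metric.cauchySeq_iff'.1 hlim.cauchySeq ε hε
  exact absurd (hN (N + 1) (by omega)) (not_lt.2 (hsep _ _ (hφ (Nat.lt_succ_self N))))

/-- Only finitely many moduli of eigenvalues exceed $a$, so some closed subinterval of $(a,b)$
avoids them. By the Fredholm alternative, a nonzero non-eigenvalue of a compact operator is in the
resolvent set. -/
lemma exists_annulus_subset_resolventSet [CompleteSpace H] {A : H →L[ℂ] H}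
    (hA : IsCompactOperator A) {a b : ℝ} (ha : 0 < a) (hab : a < b) :
    ∃ r s : ℝ, a < r ∧ r < s ∧ s < b ∧ ∀ z : ℂ, r ≤ ‖z‖ → ‖z‖ ≤ s → z ∈ resolventSet ℂ A := by
  have hfin := (finite_setOf_hasEigenvalue_le_norm hA ha).image (fun z : ℂ => ‖z‖)
  obtain ⟨x, hx⟩ := ((Set.Ioo_infinite hab).sdiff hfin).nonempty
  have hopen : IsOpen (Set.Ioo a b \ (fun z : ℂ => ‖z‖) ''
    {z : ℂ | Module.End.HasEigenvalue (A : Module.End ℂ H) z ∧ a ≤ ‖z‖}) :=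
    isOpen_Ioo.sdiff hfin.isClosed
  obtain ⟨δ, hδ, hball⟩ := Metric.nhds_basis_closedBall.mem_iff.1 (hopen.mem_nhds hx)
  rw [Real.closedBall_eq_Icc] at hball
  have h1 := (hball (Set.left_mem_Icc.2 (by linarith))).1.1
  have h2 := (hball (Set.right_mem_Icc.2 (by linarith))).1.2
  refine ⟨x - δ, x + δ, h1, by linarith, h2, fun z hz1 hz2 => ?_⟩
  have hz : z ≠ 0 := norm_pos_iff.1 (by linarith)
  refine (IsCompactOperator.hasEigenvalue_or_mem_resolventSet hA hz).resolve_left fun hev => ?_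
  exact (hball ⟨hz1, hz2⟩).2 ⟨z, ⟨hev, by linarith⟩, rfl⟩

end eigenvalues

section riesz

open Complex Metric

variable {𝒜 : Type*} [NormedRing 𝒜] [NormedAlgebra ℂ 𝒜] [CompleteSpace 𝒜]

/-- The Laurent coefficients of the resolvent of `a` on the circle of radius `r`. -/
def resolventCoeff (a : 𝒜) (r : ℝ) (n : ℤ) : 𝒜 :=
  (2 * Real.pi * I : ℂ)⁻¹ • ∮ z in C(0, r), z ^ n • resolvent a z

variable {a : 𝒜} {r s : ℝ}

lemma continuousOn_zpow_smul_resolvent (n : ℤ) {S : Set ℂ} (h0 : (0 : ℂ) ∉ S)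
    (h : S ⊆ resolventSet ℂ a) : ContinuousOn (fun z : ℂ => z ^ n • resolvent a z) S := by
  refine ContinuousOn.smul (fun z hz => ?_) fun z hz => ?_
  · exact (continuousAt_zpow₀ z n (Or.inl (by rintro rfl; exact h0 hz))).continuousWithinAt
  · exact (spectrum.hasDerivAt_resolvent_const_left (h hz)).continuousAt.continuousWithinAt

lemma circleIntegrable_zpow_smul_resolvent (hr : 0 < r) (n : ℤ)
    (h : ∀ z : ℂ, ‖z‖ = r → z ∈ resolventSet ℂ a) :
    CircleIntegrable (fun z : ℂ => z ^ n • resolvent a z) 0 r :=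
  (continuousOn_zpow_smul_resolvent n (by simp [hr.ne]) fun z hz => h z (by simpa using hz)
    ).circleIntegrable hr.le

lemma exists_norm_resolventCoeff_le (hr : 0 < r) (h : ∀ z : ℂ, ‖z‖ = r → z ∈ resolventSet ℂ a) :
    ∃ K, 0 < K ∧ ∀ n : ℤ, ‖resolventCoeff a r n‖ ≤ K * r ^ n := by
  have hc : ContinuousOn (fun z : ℂ => resolvent a z) (sphere 0 r) := fun z hz =>
    (spectrum.hasDerivAt_resolvent_const_left (h z (by simpa using hz))
      ).continuousAt.continuousWithinAt
  obtain ⟨C, hC⟩ := (isCompact_sphere (0 : ℂ) r).exists_bound_of_continuousOn hc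
  refine ⟨r * (|C| + 1), by positivity, fun n => ?_⟩
  have := circleIntegral.norm_two_pi_i_inv_smul_integral_le_of_norm_le_const (c := 0) hr.le
    (f := fun z : ℂ => z ^ n • resolvent a z) (C := r ^ n * (|C| + 1)) fun z hz => by
      have hz' : ‖z‖ = r := by simpa using hz
      rw [norm_smul, norm_zpow, hz']
      gcongr
      exact (hC z hz).trans ((le_abs_self C).trans (by linarith))
  refine this.trans (le_of_eq ?_)
  ring

lemma resolventCoeff_eq (hr : 0 < r) (hrs : r ≤ s)
    (h : ∀ z : ℂ, r ≤ ‖z‖ → ‖z‖ ≤ s → z ∈ resolventSet ℂ a) (n : ℤ) :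
    resolventCoeff a s n = resolventCoeff a r n := by
  have hsub : ∀ z ∈ closedBall (0 : ℂ) s \ ball 0 r, z ∈ resolventSet ℂ a := fun z hz =>
    h z (by simpa using hz.2) (by simpa using hz.1)
  rw [resolventCoeff, resolventCoeff,
    Complex.circleIntegral_eq_of_differentiable_on_annulus_off_countable hr hrs
      Set.countable_empty (continuousOn_zpow_smul_resolvent n (by simp [hr]) hsub)]
  intro z hz
  have hz0 : z ≠ 0 := by rintro rfl; simp [hr.le] at hz
  refine ((differentiableAt_zpow.2 (Or.inl hz0)).smul
    (spectrum.hasDerivAt_resolvent_const_left (hsub z ?_)).differentiableAt)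
  exact ⟨ball_subset_closedBall hz.1.1, fun h => hz.1.2 (ball_subset_closedBall h)⟩

omit [CompleteSpace 𝒜] in
lemma mul_resolvent {z : ℂ} (hz : z ∈ resolventSet ℂ a) :
    a * resolvent a z = z • resolvent a z - 1 ∧ resolvent a z * a = z • resolvent a z - 1 := by
  have h1 := Ring.mul_inverse_cancel _ (spectrum.mem_resolventSet_iff.1 hz)
  have h2 := Ring.inverse_mul_cancel _ (spectrum.mem_resolventSet_iff.1 hz)
  rw [sub_mul, ← Algebra.smul_def] at h1
  rw [mul_sub, ← Algebra.commutes, ← Algebra.smul_def] at h2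
  constructor
  · rw [resolvent, ← h1]; abel
  · rw [resolvent, ← h2]; abel

lemma clm_circleIntegral (L : 𝒜 →L[ℂ] 𝒜) {f : ℂ → 𝒜} {c : ℂ} (hf : CircleIntegrable f c r) :
    L (∮ z in C(c, r), f z) = ∮ z in C(c, r), L (f z) := by
  simp only [circleIntegral]
  rw [← ContinuousLinearMap.intervalIntegral_comp_comm _ hf.out]
  simp only [map_smul]

lemma integral_zpow_eq (hr : 0 < r) (n : ℤ) :
    (2 * Real.pi * I : ℂ)⁻¹ * ∮ z in C(0, r), z ^ n = if n = -1 then 1 else 0 := by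
  split_ifs with hn
  · have := circleIntegral.integral_sub_center_inv 0 hr.ne'
    simp only [sub_zero] at this
    simp only [hn, zpow_neg_one, this]
    exact inv_mul_cancel₀ (by simp [Real.pi_ne_zero])
  · have := circleIntegral.integral_sub_zpow_of_ne hn 0 0 r
    simp only [sub_zero] at this
    rw [this, mul_zero]

lemma integral_zpow_succ_sub (hr : 0 < r) (h : ∀ z : ℂ, ‖z‖ = r → z ∈ resolventSet ℂ a) (n : ℤ) :
    (2 * Real.pi * I : ℂ)⁻¹ • ∮ z in C(0, r), z ^ n • (z • resolvent a z - 1) =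
      resolventCoeff a r (n + 1) - if n = -1 then 1 else 0 := by
  have e : ∀ z ∈ sphere (0 : ℂ) r, z ^ n • (z • resolvent a z - 1) =
      z ^ (n + 1) • resolvent a z - z ^ n • (1 : 𝒜) := fun z hz => by
    have hz0 : z ≠ 0 := by rintro rfl; simp [hr.ne] at hz
    rw [smul_sub, smul_smul, zpow_add_one₀ hz0]
  have hi : CircleIntegrable (fun z : ℂ => z ^ n • (1 : 𝒜)) 0 r := by
    refine ContinuousOn.circleIntegrable hr.le (ContinuousOn.smul (fun z hz => ?_) continuousOn_const)
    refine (continuousAt_zpow₀ z n (Or.inl ?_)).continuousWithinAt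
    rintro rfl; simp [hr.ne] at hz
  rw [circleIntegral.integral_congr hr.le e,
    circleIntegral.integral_sub (circleIntegrable_zpow_smul_resolvent hr _ h) hi, smul_sub,
    circleIntegral.integral_smul_const, smul_smul, integral_zpow_eq hr]
  congr 1
  split_ifs <;> simp

/-- Multiplying the resolvent by $a$ gives $z$ times the resolvent minus $1$. The first term raises
the exponent by one, and the second integrates to zero unless the exponent is $-1$. -/
lemma mul_resolventCoeff (hr : 0 < r) (h : ∀ z : ℂ, ‖z‖ = r → z ∈ resolventSet ℂ a) (n : ℤ) :
    a * resolventCoeff a r n = resolventCoeff a r (n + 1) - (if n = -1 then 1 else 0) ∧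
    resolventCoeff a r n * a = resolventCoeff a r (n + 1) - if n = -1 then 1 else 0 := by
  rw [← integral_zpow_succ_sub hr h]
  have hi := circleIntegrable_zpow_smul_resolvent hr n h
  constructor
  · rw [resolventCoeff, mul_smul_comm]
    have := clm_circleIntegral (ContinuousLinearMap.mul ℂ 𝒜 a) hi
    simp only [ContinuousLinearMap.mul_apply'] at this
    rw [this]
    congr 1
    refine circleIntegral.integral_congr hr.le fun z hz => ?_
    rw [mul_smul_comm, (mul_resolvent (h z (by simpa using hz))).1]
  · rw [resolventCoeff, smul_mul_assoc]
    have := clm_circleIntegral ((ContinuousLinearMap.mul ℂ 𝒜).flip a) hi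
    simp only [ContinuousLinearMap.flip_apply, ContinuousLinearMap.mul_apply'] at this
    rw [this]
    congr 1
    refine circleIntegral.integral_congr hr.le fun z hz => ?_
    rw [smul_mul_assoc, (mul_resolvent (h z (by simpa using hz))).2]

/-- The Riesz projection `q` onto the part of the spectrum inside an annulus in the resolvent
set. -/
theorem exists_spectral_projection (hr : 0 < r) (hrs : r < s)
    (h : ∀ z : ℂ, r ≤ ‖z‖ → ‖z‖ ≤ s → z ∈ resolventSet ℂ a) :
    ∃ (q : 𝒜) (K : ℝ), 0 < K ∧ q * q = q ∧ a * q = q * a ∧ (∀ n : ℕ, ‖a ^ n * q‖ ≤ K * r ^ n) ∧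
      ∀ n : ℕ, 0 < n → ∃ w : 𝒜, w * a ^ n = 1 - q ∧ s ^ n * ‖w‖ ≤ K := by
  have hs : 0 < s := hr.trans hrs
  have hr' : ∀ z : ℂ, ‖z‖ = r → z ∈ resolventSet ℂ a := fun z hz => h z hz.ge (by linarith)
  have hs' : ∀ z : ℂ, ‖z‖ = s → z ∈ resolventSet ℂ a := fun z hz => h z (by linarith) hz.le
  obtain ⟨K₁, hK₁, hb₁⟩ := exists_norm_resolventCoeff_le hr hr'
  obtain ⟨K₂, hK₂, hb₂⟩ := exists_norm_resolventCoeff_le hs hs'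
  have hmul := mul_resolventCoeff hr hr'
  -- With $c_n$ the Laurent coefficients, $q=c_0$ and $a^nq=c_n$, which is $O(r^n)$ on the inner
  -- circle.
  have hinside : ∀ n : ℕ, a ^ n * resolventCoeff a r 0 = resolventCoeff a r n := fun n => by
    induction n with
    | zero => simp
    | succ n ih =>
      rw [pow_succ', mul_assoc, ih, (hmul n).1, if_neg (by omega), sub_zero]
      push_cast; rfl
  have houtside : ∀ n : ℕ,
      a ^ (n + 1) * resolventCoeff a r (-(n + 1)) = resolventCoeff a r 0 - 1 ∧
      resolventCoeff a r (-(n + 1)) * a ^ (n + 1) = resolventCoeff a r 0 - 1 := fun n => by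
    induction n with
    | zero =>
      have := hmul (-1)
      simpa using this
    | succ n ih =>
      have h1 := hmul (-((n + 1 : ℕ) + 1))
      rw [if_neg (by push_cast; omega), sub_zero,
        show -(((n + 1 : ℕ) : ℤ) + 1) + 1 = -(n + 1) by push_cast; ring] at h1
      constructor
      · rw [pow_succ a (n + 1), mul_assoc, h1.1, ih.1]
      · rw [pow_succ' a (n + 1), ← mul_assoc, h1.2, ih.2]
  -- Moving the contour to the outer circle gives decay $s^{-n}$ for the negative coefficients.
  -- Since $c_{-n}a^n=q-1$, the element $-c_{-n}$ inverts $a^n$ on the complementary part.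
  have hbo : ∀ n : ℕ, s ^ (n + 1) * ‖resolventCoeff a r (-(n + 1))‖ ≤ K₂ := fun n => by
    have h1 := hb₂ (-(n + 1))
    rw [resolventCoeff_eq hr hrs.le h] at h1
    calc s ^ (n + 1) * ‖resolventCoeff a r (-(n + 1))‖ ≤ s ^ (n + 1) * (K₂ * s ^ (-(n + 1) : ℤ)) := by
          gcongr
      _ = K₂ := by
          rw [zpow_neg]
          have : s ^ ((n : ℤ) + 1) = s ^ (n + 1) := by norm_cast
          rw [this]
          field_simp
  set q := resolventCoeff a r 0 with hq
  have hbi : ∀ n : ℕ, ‖a ^ n * q‖ ≤ K₁ * r ^ n := fun n => by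
    rw [hinside]
    simpa using hb₁ n
  have hcomm : a * q = q * a := by
    rw [(hmul 0).1, (hmul 0).2]
  -- Idempotence from the gap: $q(q-1)=(a^nq)c_{-n}$ is $O((r/s)^n)$ for every $n\ge1$, so no
  -- product of contour integrals is needed.
  have hqq : q * (q - 1) = 0 := by
    have hle : ∀ n : ℕ, ‖q * (q - 1)‖ ≤ K₁ * K₂ * (r / s) ^ (n + 1) := fun n => by
      have hc : Commute (a ^ (n + 1)) q := Commute.pow_left hcomm _
      rw [← (houtside n).1, ← mul_assoc, ← hc.eq]
      have h1 : ‖resolventCoeff a r (-(n + 1))‖ ≤ K₂ / s ^ (n + 1) := by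
        rw [le_div_iff₀ (by positivity), mul_comm]; exact hbo n
      calc _ ≤ (K₁ * r ^ (n + 1)) * (K₂ / s ^ (n + 1)) :=
            (norm_mul_le _ _).trans (mul_le_mul (hbi _) h1 (norm_nonneg _) (by positivity))
        _ = _ := by rw [div_pow]; ring
    have hlim : Tendsto (fun n : ℕ => K₁ * K₂ * (r / s) ^ (n + 1)) atTop (𝓝 0) := by
      have := (tendsto_pow_atTop_nhds_zero_of_lt_one (r := r / s) (by positivity)
        ((div_lt_one hs).2 hrs)).const_mul (K₁ * K₂)
      rw [mul_zero] at this
      exact this.comp (tendsto_add_atTop_nat 1)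
    exact norm_le_zero_iff.1 (ge_of_tendsto' hlim hle)
  refine ⟨q, max K₁ K₂, by positivity, ?_, hcomm, fun n => ?_, fun n hn => ?_⟩
  · rw [mul_sub, mul_one, sub_eq_zero] at hqq
    exact hqq
  · exact (hbi n).trans (by gcongr; exact le_max_left _ _)
  · obtain ⟨n, rfl⟩ : ∃ m, n = m + 1 := ⟨n - 1, by omega⟩
    refine ⟨-resolventCoeff a r (-(n + 1)), ?_, ?_⟩
    · rw [neg_mul, (houtside n).2, neg_sub]
    · rw [norm_neg]
      exact (hbo n).trans (le_max_right _ _)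

end riesz

end OperatorSemigroup

/-! ### Cone invariance under small perturbations -/

namespace OperatorSemigroup

variable {H : Type*} [NormedAddCommGroup H] [NormedSpace ℂ H]

/-- A small perturbation of an operator with a dominated splitting preserves the cone around the
dominating part and expands it. -/
lemma cone_expansion {q D D' : H →L[ℂ] H} {α β ε : ℝ} (hDq : D * q = q * D)
    (hα : ∀ v, α * ‖(1 - q) v‖ ≤ ‖D ((1 - q) v)‖) (hβ : ∀ v, ‖D (q v)‖ ≤ β * ‖q v‖)
    (hβ0 : 0 ≤ β) (hβα : 4 * β ≤ α) (hε : ‖D' - D‖ ≤ ε) (hε1 : 8 * (‖1 - q‖ * ε) ≤ α)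
    (hε2 : 8 * (‖q‖ * ε) ≤ α) {x : H} (hx : ‖q x‖ ≤ ‖(1 - q) x‖) :
    ‖q (D' x)‖ ≤ ‖(1 - q) (D' x)‖ ∧ α / 2 * ‖(1 - q) x‖ ≤ ‖(1 - q) (D' x)‖ := by
  set P : H →L[ℂ] H := 1 - q with hP
  have hDP : D * P = P * D := by rw [hP, mul_sub, sub_mul, hDq, mul_one, one_mul]
  have cq : ∀ v, q (D v) = D (q v) := fun v =>
    (congrArg (fun f : H →L[ℂ] H => f v) hDq).symm
  have cP : ∀ v, P (D v) = D (P v) := fun v =>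
    (congrArg (fun f : H →L[ℂ] H => f v) hDP).symm
  have hsplit : D' x = D x + (D' - D) x := by simp
  have hxP : ‖x‖ ≤ 2 * ‖P x‖ := by
    have : x = P x + q x := by simp [hP]
    calc ‖x‖ ≤ ‖P x‖ + ‖q x‖ := by conv_lhs => rw [this]
                                   exact norm_add_le _ _
      _ ≤ _ := by linarith
  have hpert : ‖(D' - D) x‖ ≤ ε * (2 * ‖P x‖) := by
    have hε0 := (norm_nonneg _).trans hε
    exact (ContinuousLinearMap.le_of_opNorm_le _ hε x).trans (by gcongr)
  have n1 : ‖P ((D' - D) x)‖ ≤ α / 4 * ‖P x‖ := by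
    calc _ ≤ ‖P‖ * (ε * (2 * ‖P x‖)) := (P.le_opNorm _).trans (by gcongr)
      _ = (2 * (‖P‖ * ε)) * ‖P x‖ := by ring
      _ ≤ _ := by gcongr; linarith
  have n2 : ‖q ((D' - D) x)‖ ≤ α / 4 * ‖P x‖ := by
    calc _ ≤ ‖q‖ * (ε * (2 * ‖P x‖)) := (q.le_opNorm _).trans (by gcongr)
      _ = (2 * (‖q‖ * ε)) * ‖P x‖ := by ring
      _ ≤ _ := by gcongr; linarith
  -- The perturbation costs at most $\alpha/4$ in each component. The dominating part keeps
  -- $3\alpha/4$ and the other is at most $\beta+\alpha/4\le\alpha/2$, so the cone is preserved.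
  have l1 : (α - α / 4) * ‖P x‖ ≤ ‖P (D' x)‖ := by
    rw [hsplit, map_add, cP]
    have h1 := norm_sub_le_norm_add (D (P x)) (P ((D' - D) x))
    have h2 := hα x
    nlinarith
  have l2 : ‖q (D' x)‖ ≤ (α / 2) * ‖P x‖ := by
    rw [hsplit, map_add, cq]
    have h1 := norm_add_le (D (q x)) (q ((D' - D) x))
    have h2 := hβ x
    have h3 : β * ‖q x‖ ≤ α / 4 * ‖P x‖ := mul_le_mul (by linarith) hx (norm_nonneg _) (by linarith)
    linarith
  have hα0 : 0 ≤ α * ‖P x‖ := mul_nonneg (by linarith) (norm_nonneg _)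
  constructor <;> linarith

lemma apply_natCast_eq_pow {S : ℝ → H →L[ℂ] H} (h0 : S 0 = 1)
    (hadd : ∀ s t : ℝ, 0 ≤ s → 0 ≤ t → S (s + t) = S s * S t) {a : ℝ} (ha : 0 ≤ a) (n : ℕ) :
    S (a * n) = S a ^ n := by
  induction n with
  | zero => simpa using h0
  | succ n ih =>
    rw [Nat.cast_succ, mul_add, mul_one, hadd _ _ (by positivity) ha, ih, pow_succ]

end OperatorSemigroup

/-! ### Stability of exponential growth -/

namespace OperatorSemigroup

variable {H : Type*} [NormedAddCommGroup H] [InnerProductSpace ℂ H] [CompleteSpace H]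

/-- Exponential growth of an orbit of an eventually compact semigroup is stable under perturbation
of the semigroup and of the initial value. -/
theorem exists_uniform_growth {S : ℝ → ℝ → H →L[ℂ] H} {ρ : ℝ} (hρ : 0 < ρ)
    (h0 : ∀ κ, |1 - κ| ≤ ρ → S κ 0 = 1)
    (hadd : ∀ κ, |1 - κ| ≤ ρ → ∀ s t : ℝ, 0 ≤ s → 0 ≤ t → S κ (s + t) = S κ s * S κ t)
    (hlip : ∀ t, 0 < t → ∃ L, 0 < L ∧ ∀ κ, |1 - κ| ≤ ρ → ‖S κ t - S 1 t‖ ≤ L * |1 - κ|)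
    (hbd : ∀ a : ℝ, ∃ K, 0 < K ∧ ∀ κ, |1 - κ| ≤ ρ → ∀ t, 0 ≤ t → t ≤ a → ‖S κ t‖ ≤ K)
    (hcpt : IsCompactOperator (S 1 1)) {u : H} (hu : ‖u‖ = 1) {p : ℝ} (hp : 0 < p)
    (hgrow : ∀ᶠ n : ℕ in atTop, Real.exp (7 / 8 * p * n) ≤ ‖S 1 n u‖) :
    ∃ κ₀ > (0 : ℝ), κ₀ ≤ ρ ∧ ∃ η₀ > (0 : ℝ), ∃ C > (0 : ℝ), ∃ τ > (0 : ℝ),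
      ∀ (κ : ℝ) (x : H), |1 - κ| ≤ κ₀ → ‖x - u‖ ≤ η₀ → ∀ t : ℝ, τ ≤ t →
        C * Real.exp (p / 2 * t) * ‖x‖ ≤ ‖S κ t x‖ := by
  have hone : |1 - (1 : ℝ)| ≤ ρ := by simpa using hρ.le
  have hpow : ∀ n : ℕ, S 1 n = S 1 1 ^ n := fun n => by
    simpa using apply_natCast_eq_pow (h0 1 hone) (hadd 1 hone) zero_le_one n
  -- The radii are placed between the rate $p/2$ to be proved and $3p/4$, below the rate $7p/8$
  -- known for the orbit of $u$.
  obtain ⟨r, s, hr, hrs, hs, hres⟩ := exists_annulus_subset_resolventSet hcpt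
    (Real.exp_pos (p / 2)) (Real.exp_lt_exp.2 (by linarith : p / 2 < 3 / 4 * p))
  have hr0 : 0 < r := (Real.exp_pos _).trans hr
  have hs0 : 0 < s := hr0.trans hrs
  obtain ⟨q, K, hK, hqq, hAq, hin, hout⟩ := exists_spectral_projection hr0 hrs hres
  set A := S 1 1 with hA
  set P : H →L[ℂ] H := 1 - q with hP
  have hqq' : ∀ v, q (q v) = q v := fun v => congrArg (fun f : H →L[ℂ] H => f v) hqq
  have hPP' : ∀ v, P (P v) = P v := fun v => by simp [hP, hqq']
  have hAnq : ∀ n : ℕ, A ^ n * q = q * A ^ n := fun n => (Commute.pow_left hAq n : Commute _ _)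
  have hAnP : ∀ n : ℕ, A ^ n * P = P * A ^ n := fun n => by
    rw [hP, mul_sub, sub_mul, hAnq, mul_one, one_mul]
  have cP : ∀ (n : ℕ) v, P ((A ^ n) v) = (A ^ n) (P v) := fun n v =>
    (congrArg (fun f : H →L[ℂ] H => f v) (hAnP n)).symm
  have cq : ∀ (n : ℕ) v, q ((A ^ n) v) = (A ^ n) (q v) := fun n v =>
    (congrArg (fun f : H →L[ℂ] H => f v) (hAnq n)).symm
  have hinv : ∀ (n : ℕ) v, ‖(A ^ n) (q v)‖ ≤ K * r ^ n * ‖q v‖ := fun n v => by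
    have := ContinuousLinearMap.le_of_opNorm_le _ (hin n) (q v)
    rwa [mul_apply_eq_comp, hqq'] at this
  have houtv : ∀ (n : ℕ) v, 0 < n → s ^ n / K * ‖P v‖ ≤ ‖(A ^ n) (P v)‖ := fun n v hn => by
    obtain ⟨w, hw1, hw2⟩ := hout n hn
    have h1 : w ((A ^ n) (P v)) = P v := by
      have := congrArg (fun f : H →L[ℂ] H => f (P v)) hw1
      simp only [mul_apply_eq_comp] at this
      rw [this, hPP']
    have h2 := w.le_opNorm ((A ^ n) (P v))
    rw [h1] at h2
    rw [div_mul_eq_mul_div, div_le_iff₀ hK]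
    calc s ^ n * ‖P v‖ ≤ s ^ n * (‖w‖ * ‖(A ^ n) (P v)‖) := by gcongr
      _ = (s ^ n * ‖w‖) * ‖(A ^ n) (P v)‖ := by ring
      _ ≤ K * ‖(A ^ n) (P v)‖ := by gcongr
      _ = _ := mul_comm _ _
  have hratio : Tendsto (fun n : ℕ => (s / r) ^ n) atTop atTop :=
    tendsto_pow_atTop_atTop_of_one_lt ((one_lt_div hr0).2 hrs)
  -- Otherwise $u=qu$ and the orbit is at most $Kr^n\le Ke^{3pn/4}$, against growth at rate $7p/8$.
  have hPu : 0 < ‖P u‖ := by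
    rw [norm_pos_iff]
    intro hzero
    have hqu : q u = u := by
      have : P u = u - q u := by simp [hP]
      rw [hzero] at this
      exact (sub_eq_zero.1 this.symm).symm
    have hbig : Tendsto (fun n : ℕ => Real.exp (p / 8 * n)) atTop atTop :=
      Real.tendsto_exp_atTop.comp (tendsto_natCast_atTop_atTop.const_mul_atTop (by positivity))
    obtain ⟨n, hn1, hn2⟩ := (hgrow.and (hbig.eventually_gt_atTop K)).exists
    have h1 := hinv n u
    rw [hqu, hu, mul_one, ← hpow] at h1
    have h2 : r ^ n ≤ Real.exp (3 / 4 * p * n) := by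
      rw [mul_comm _ (n : ℝ), Real.exp_nat_mul]
      exact pow_le_pow_left₀ hr0.le (hrs.trans hs).le n
    have h3 : Real.exp (7 / 8 * p * n) = Real.exp (p / 8 * n) * Real.exp (3 / 4 * p * n) := by
      rw [← Real.exp_add]; congr 1; ring
    have h4 : K * r ^ n < Real.exp (7 / 8 * p * n) := by
      rw [h3]
      exact mul_lt_mul hn2 h2 (by positivity) (by positivity)
    linarith
  -- $N$ is the iteration step: the $K$ in the maximum gives the gap $4Kr^N\le\alpha$ required by
  -- `cone_expansion`, the $1$ gives $e^{pN/2}\le r^N\le\alpha/2$.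
  obtain ⟨N, hN, hN1⟩ := ((hratio.eventually_ge_atTop (4 * K * max K 1)).and
    (eventually_gt_atTop 0)).exists
  -- $m$ is the entry time: the orbit of $u$ is then strictly inside the cone, an open condition.
  obtain ⟨m, hm, hm1⟩ := ((hratio.eventually_gt_atTop (K * K * ‖q u‖ / ‖P u‖)).and
    (eventually_gt_atTop 0)).exists
  have hNpos : (0 : ℝ) < N := by exact_mod_cast hN1
  have hmpos : (0 : ℝ) < m := by exact_mod_cast hm1
  set α := s ^ N / K with hα
  have hα0 : 0 < α := by positivity
  have hrα : 4 * (max K 1 * r ^ N) ≤ α := by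
    rw [div_pow, le_div_iff₀ (by positivity)] at hN
    rw [hα, le_div_iff₀ hK]
    linarith
  have hβα : 4 * (K * r ^ N) ≤ α := by
    refine le_trans ?_ hrα
    gcongr
    exact le_max_left _ _
  have hgα : Real.exp (p / 2 * N) ≤ α / 2 := by
    have h1 : Real.exp (p / 2 * N) ≤ 1 * r ^ N := by
      rw [mul_comm, Real.exp_nat_mul, one_mul]
      exact pow_le_pow_left₀ (Real.exp_pos _).le hr.le N
    have h2 : 1 * r ^ N ≤ max K 1 * r ^ N := by gcongr; exact le_max_right _ _
    linarith
  have hcone : ‖q (S 1 m u)‖ < ‖P (S 1 m u)‖ := by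
    rw [hpow, cP, cq]
    refine (hinv m u).trans_lt (lt_of_lt_of_le ?_ (houtv m u hm1))
    rw [div_pow, div_lt_div_iff₀ hPu (by positivity)] at hm
    rw [div_mul_eq_mul_div, lt_div_iff₀ hK]
    linarith
  have hc0 : 0 < ‖P (S 1 m u)‖ := (norm_nonneg _).trans_lt hcone
  obtain ⟨L₁, hL₁, hlip₁⟩ := hlip N hNpos
  obtain ⟨L₂, hL₂, hlip₂⟩ := hlip m hmpos
  obtain ⟨M, hM, hMb⟩ := hbd N
  have hev : Continuous fun y : (H →L[ℂ] H) × H => y.1 y.2 :=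
    continuous_fst.clm_apply continuous_snd
  -- an open neighbourhood of `(S 1 m, u)` on which the cone condition persists
  have hopen : IsOpen {y : (H →L[ℂ] H) × H | ‖q (y.1 y.2)‖ < ‖P (y.1 y.2)‖ ∧
      ‖P (S 1 m u)‖ / 2 < ‖P (y.1 y.2)‖} :=
    (isOpen_lt (q.continuous.comp hev).norm (P.continuous.comp hev).norm).and
      (isOpen_lt continuous_const (P.continuous.comp hev).norm)
  obtain ⟨δ, hδ, hball⟩ := Metric.nhds_basis_closedBall.mem_iff.1
    (hopen.mem_nhds (show (S 1 m, u) ∈ _ from ⟨hcone, half_lt_self hc0⟩))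
  set Λ := ‖P‖ + ‖q‖ + 1 with hΛ
  have hΛ0 : 0 < Λ := by positivity
  -- $\delta/L_2$ makes the perturbed orbit enter the cone at time $m$, and $\alpha/(8\Lambda L_1)$
  -- is the smallness for one step of length $N$. In the constant, $4$ combines the halved norm at
  -- entry with $\|x\|\le2$, $\Lambda M$ accounts for overshooting $t$, and the exponential for the
  -- waiting time $m$.
  refine ⟨min ρ (min (δ / L₂) (α / (8 * Λ * L₁))), by positivity, min_le_left _ _,
    min δ 1, by positivity,
    ‖P (S 1 m u)‖ / (4 * Λ * M) * Real.exp (-(p / 2 * m)), by positivity, m, hmpos,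
    fun κ x hκ hx t ht => ?_⟩
  have hκρ := hκ.trans (min_le_left _ _)
  have hκ2 := (hκ.trans (min_le_right _ _)).trans (min_le_left _ _)
  have hκ1 := (hκ.trans (min_le_right _ _)).trans (min_le_right _ _)
  rw [le_div_iff₀ hL₂] at hκ2
  rw [le_div_iff₀ (by positivity)] at hκ1
  have hstart : (S κ m, x) ∈ Metric.closedBall (S 1 m, u) δ := by
    rw [Metric.mem_closedBall, Prod.dist_eq, max_le_iff, dist_eq_norm, dist_eq_norm]
    refine ⟨(hlip₂ κ hκρ).trans (by linarith), hx.trans (min_le_left _ _)⟩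
  obtain ⟨hst1, hst2⟩ := hball hstart
  simp only at hst1 hst2
  have hxn : ‖x‖ ≤ 2 := by
    calc ‖x‖ = ‖(x - u) + u‖ := by simp
      _ ≤ ‖x - u‖ + ‖u‖ := norm_add_le _ _
      _ ≤ 1 + 1 := add_le_add (hx.trans (min_le_right _ _)) hu.le
      _ = 2 := by norm_num
  have hDε : Λ * (L₁ * |1 - κ|) ≤ α / 8 := by linarith
  have hε0 : 0 ≤ L₁ * |1 - κ| := by positivity
  have hstep : ∀ y, ‖q y‖ ≤ ‖P y‖ → ‖q (S κ N y)‖ ≤ ‖P (S κ N y)‖ ∧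
      α / 2 * ‖P y‖ ≤ ‖P (S κ N y)‖ := fun y hy => by
    refine cone_expansion (D := S 1 N) (β := K * r ^ N) (ε := L₁ * |1 - κ|) ?_ ?_ ?_ (by positivity)
      hβα (hlip₁ κ hκρ) ?_ ?_ hy
    · rw [hpow]; exact hAnq N
    · rw [hpow]; exact fun v => houtv N v hN1
    · rw [hpow]; exact fun v => hinv N v
    · have : ‖P‖ * (L₁ * |1 - κ|) ≤ Λ * (L₁ * |1 - κ|) := by
        gcongr; rw [hΛ]; linarith [norm_nonneg q]
      rw [← hP]; linarith
    · have : ‖q‖ * (L₁ * |1 - κ|) ≤ Λ * (L₁ * |1 - κ|) := by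
        gcongr; rw [hΛ]; linarith [norm_nonneg P]
      linarith
  have hiter : ∀ j : ℕ, ‖q ((S κ N ^ j) (S κ m x))‖ ≤ ‖P ((S κ N ^ j) (S κ m x))‖ ∧
      Real.exp (p / 2 * N) ^ j * ‖P (S κ m x)‖ ≤ ‖P ((S κ N ^ j) (S κ m x))‖ := fun j => by
    induction j with
    | zero => simpa using hst1.le
    | succ j ih =>
      obtain ⟨h1, h2⟩ := hstep _ ih.1
      rw [pow_succ' (S κ N), mul_apply_eq_comp]
      refine ⟨h1, ?_⟩
      calc _ = Real.exp (p / 2 * N) * (Real.exp (p / 2 * N) ^ j * ‖P (S κ m x)‖) := by ring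
        _ ≤ α / 2 * ‖P ((S κ N ^ j) (S κ m x))‖ :=
            mul_le_mul hgα ih.2 (by positivity) (by positivity)
        _ ≤ _ := h2
  -- Time is rounded up to the grid $m+N\mathbb N$: a lower bound at the later grid time passes back
  -- to $t$, because evolving for at most $N$ multiplies norms by at most $M$.
  obtain ⟨j, hj1, hj2⟩ : ∃ j : ℕ, t ≤ m + N * j ∧ m + N * j ≤ t + N := by
    refine ⟨⌈(t - m) / N⌉₊, ?_, ?_⟩
    · have := Nat.le_ceil ((t - m) / N)
      rw [div_le_iff₀ hNpos] at this
      linarith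
    · have := Nat.ceil_lt_add_one (a := (t - m) / N) (div_nonneg (by linarith) hNpos.le)
      rw [← sub_lt_iff_lt_add, lt_div_iff₀ hNpos] at this
      linarith
  have ht0 : 0 ≤ t := hmpos.le.trans ht
  have e1 : (S κ N ^ j) (S κ m x) = S κ (m + N * j - t) (S κ t x) := by
    rw [← apply_natCast_eq_pow (h0 κ hκρ) (hadd κ hκρ) hNpos.le, ← mul_apply_eq_comp,
      ← mul_apply_eq_comp, ← hadd κ hκρ _ _ (by positivity) hmpos.le,
      ← hadd κ hκρ _ _ (by linarith) ht0]
    congr 2; ring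
  have h1 : Real.exp (p / 2 * N) ^ j * ‖P (S κ m x)‖ ≤ Λ * (M * ‖S κ t x‖) := by
    refine (hiter j).2.trans ?_
    rw [e1]
    refine (P.le_opNorm _).trans ?_
    gcongr
    · rw [hΛ]; linarith [norm_nonneg q]
    · exact ContinuousLinearMap.le_of_opNorm_le _
        (hMb κ hκρ _ (by linarith) (by linarith)) _
  have h2 : Real.exp (-(p / 2 * m)) * Real.exp (p / 2 * t) ≤ Real.exp (p / 2 * N) ^ j := by
    rw [← Real.exp_add, ← Real.exp_nat_mul]
    apply Real.exp_le_exp.2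
    have : p / 2 * t ≤ p / 2 * (m + N * j) := by gcongr
    linarith
  have h3 : (Real.exp (-(p / 2 * m)) * Real.exp (p / 2 * t)) * (‖P (S 1 m u)‖ / 2) ≤
      Λ * (M * ‖S κ t x‖) :=
    le_trans (mul_le_mul h2 hst2.le (by positivity) (by positivity)) h1
  calc ‖P (S 1 m u)‖ / (4 * Λ * M) * Real.exp (-(p / 2 * m)) * Real.exp (p / 2 * t) * ‖x‖
      ≤ ‖P (S 1 m u)‖ / (4 * Λ * M) * Real.exp (-(p / 2 * m)) * Real.exp (p / 2 * t) * 2 := by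
        gcongr
    _ = ((Real.exp (-(p / 2 * m)) * Real.exp (p / 2 * t)) * (‖P (S 1 m u)‖ / 2)) / (Λ * M) := by
        field_simp; ring
    _ ≤ (Λ * (M * ‖S κ t x‖)) / (Λ * M) := by gcongr
    _ = ‖S κ t x‖ := by field_simp

lemma liminf_coe_le_of_tendsto_sub {f g : ℝ → ℝ} (h : Tendsto (fun t => f t - g t) atTop (𝓝 0)) :
    liminf (fun t => (f t : EReal)) atTop ≤ liminf (fun t => (g t : EReal)) atTop := by
  refine le_of_forall_lt fun c hc => ?_
  obtain ⟨a, hca, ha⟩ := EReal.lt_iff_exists_real_btwn.1 hc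
  obtain ⟨b, hab, hb⟩ := EReal.lt_iff_exists_real_btwn.1 ha
  have hab' : a < b := by exact_mod_cast hab
  refine hca.trans_le (le_liminf_of_le (by isBoundedDefault) ?_)
  filter_upwards [eventually_lt_of_lt_liminf hb, h.eventually (gt_mem_nhds (sub_pos.2 hab'))]
    with t h1 h2
  have h1' : b < f t := by exact_mod_cast h1
  exact_mod_cast (by linarith : a ≤ g t)

omit [CompleteSpace H] in
-- Scaling changes the logarithm by at most a constant, which division by $t$ removes in the limit;
-- this also holds where the orbit vanishes, with `Real.log 0 = 0`.
lemma growthRate_smul (T : H →ₗ.[ℂ] H) {c : ℂ} (hc : c ≠ 0) (x : H) :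
    growthRate T (c • x) = growthRate T x := by
  have hlim : Tendsto (fun t : ℝ => |Real.log ‖c‖| * (1 / t)) atTop (𝓝 0) := by
    simpa using tendsto_inv_atTop_zero.const_mul |Real.log ‖c‖|
  have key : Tendsto (fun t : ℝ => 1 / t * Real.log ‖expSemigroup T t (c • x)‖ -
      1 / t * Real.log ‖expSemigroup T t x‖) atTop (𝓝 0) := by
    refine squeeze_zero_norm' ?_ hlim
    filter_upwards [eventually_gt_atTop 0] with t ht
    rw [← mul_sub, map_smul, norm_smul, norm_mul, mul_comm, Real.norm_eq_abs, Real.norm_eq_abs,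
      abs_of_pos (one_div_pos.2 ht)]
    refine mul_le_mul_of_nonneg_right ?_ (one_div_pos.2 ht).le
    rcases eq_or_ne ‖expSemigroup T t x‖ 0 with h0 | h0
    · simp [h0]
    · rw [Real.log_mul (norm_ne_zero_iff.2 hc) h0, add_sub_cancel_right]
  refine le_antisymm (liminf_coe_le_of_tendsto_sub key) (liminf_coe_le_of_tendsto_sub ?_)
  simpa using key.neg

omit [CompleteSpace H] in
lemma eventually_exp_le_of_lt_growthRate {T : H →ₗ.[ℂ] H} {x : H} {a : ℝ} (ha : 0 ≤ a)
    (h : (a : EReal) < growthRate T x) :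
    ∀ᶠ t : ℝ in atTop, Real.exp (a * t) ≤ ‖expSemigroup T t x‖ := by
  filter_upwards [eventually_lt_of_lt_liminf h, eventually_gt_atTop 0] with t h1 ht
  have h1' : a < 1 / t * Real.log ‖expSemigroup T t x‖ := by exact_mod_cast h1
  rw [one_div, ← div_eq_inv_mul, lt_div_iff₀ ht] at h1'
  -- A vanishing orbit would have logarithm $0$ by convention, which the rate $a\ge0$ excludes.
  have hpos : 0 < ‖expSemigroup T t x‖ := by
    refine lt_of_le_of_ne (norm_nonneg _) fun h0 => ?_
    rw [← h0, Real.log_zero] at h1'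
    exact absurd h1' (not_lt.2 (by positivity))
  rw [← Real.le_log_iff_exp_le hpos]
  exact h1'.le

end OperatorSemigroup

end

theorem lemma2p3 {H : Type*} [NormedAddCommGroup H] [InnerProductSpace ℂ H] [CompleteSpace H]
    (T₀ T₁ : H →ₗ.[ℂ] H)
    (hsa : IsSelfAdjoint T₀)
    (hneg : OperatorSemigroup.IsNegative T₀)
    (hcomp : OperatorSemigroup.HasCompactResolvent T₀)
    (hrel : OperatorSemigroup.IsInfinitesimallyBounded T₀ T₁)
    -- `u` is the direction of the vectors `x₀` below
    (u : H) (hu : ‖u‖ = 1) :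
    ∃ κ₀ > (0 : ℝ), ∃ η₀ > (0 : ℝ), ∃ C > (0 : ℝ), ∃ τ > (0 : ℝ),
      (∀ κ : ℝ, |1 - κ| ≤ κ₀ →
        OperatorSemigroup.Generates (OperatorSemigroup.family T₀ T₁ κ)) ∧
      ∀ (x₀ : H) (p : ℝ), x₀ ≠ 0 → ((‖x₀‖⁻¹ : ℝ) : ℂ) • x₀ = u → 0 < p →
        OperatorSemigroup.growthRate (OperatorSemigroup.family T₀ T₁ 1) x₀ = (p : EReal) →
        ∀ (κ : ℝ) (x : H), |1 - κ| ≤ κ₀ → ‖x - x₀‖ ≤ η₀ * ‖x₀‖ →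
          ∀ t : ℝ, τ ≤ t →
            C * Real.exp (p / 2 * t) * ‖x‖ ≤
              ‖OperatorSemigroup.expSemigroup (OperatorSemigroup.family T₀ T₁ κ) t x‖ := by
  open OperatorSemigroup in
  obtain ⟨ω, R, hR, hRd, hRc⟩ := exists_halfPlaneResolvent_family hsa hneg hrel hcomp
  have hhalf : ∀ κ : ℝ, |1 - κ| ≤ 1 / 2 → 1 / 2 ≤ κ := fun κ hκ => by
    linarith [(abs_le.1 hκ).2]
  have hgen : ∀ κ : ℝ, |1 - κ| ≤ 1 / 2 → Generates (family T₀ T₁ κ) := fun κ hκ =>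
    (hR κ (hhalf κ hκ)).generates
  -- The rate is determined by the direction $u$, so $p$ can be fixed before the constants are
  -- chosen. If $u$ has no positive finite rate, the growth claim is vacuous and any constants
  -- serve.
  by_cases hp : ∃ p : ℝ, 0 < p ∧ growthRate (family T₀ T₁ 1) u = (p : EReal)
  swap
  · refine ⟨1 / 2, by norm_num, 1, one_pos, 1, one_pos, 1, one_pos, hgen,
      fun x₀ p hx₀ hxu hp0 hgr => ?_⟩
    refine absurd ⟨p, hp0, ?_⟩ hp
    rw [← hxu, growthRate_smul _ (by simpa using hx₀), hgr]
  obtain ⟨p, hp, hgr⟩ := hp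
  have hsg := fun κ (hκ : |1 - κ| ≤ 1 / 2) => (hR κ (hhalf κ hκ)).isC0Semigroup
  have hexp : ∀ κ : ℝ, |1 - κ| ≤ 1 / 2 → ∀ t : ℝ, 0 ≤ t →
      expSemigroup (family T₀ T₁ κ) t = laplaceSemigroup (R κ) ω t := fun κ hκ t ht =>
    (hR κ (hhalf κ hκ)).expSemigroup_eq ht
  have hone : |1 - (1 : ℝ)| ≤ 1 / 2 := by norm_num
  have hR1 := (hR 1 (hhalf 1 hone)).isHalfPlaneResolvent
  obtain ⟨κ₀, hκ₀, hκρ, η₀, hη₀, C, hC, τ, hτ, hmain⟩ := exists_uniform_growth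
    (S := fun κ => laplaceSemigroup (R κ) ω) (ρ := 1 / 2) (by norm_num)
    (fun κ hκ => (hsg κ hκ).zero) (fun κ hκ => (hsg κ hκ).add)
    (fun t ht => ⟨2 * Real.exp (ω * t + 1) * 8, by positivity, fun κ hκ => by
      have := (hR κ (hhalf κ hκ)).isHalfPlaneResolvent.norm_laplaceSemigroup_sub_le hR1
        (hRd κ (hhalf κ hκ)) ht
      linarith⟩)
    (fun a => by
      refine ⟨max 1 (2 ^ 2 * Real.exp (ω * a + 1) / 2), by positivity, fun κ hκ t ht hta => ?_⟩
      rcases eq_or_lt_of_le ht with rfl | ht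
      · rw [(hsg κ hκ).zero]
        exact ContinuousLinearMap.norm_id_le.trans (le_max_left _ _)
      · refine ((hR κ (hhalf κ hκ)).isHalfPlaneResolvent.norm_laplaceSemigroup_le ht).trans
          (le_trans ?_ (le_max_right _ _))
        have := hR1.pos
        gcongr)
    (hR1.laplaceSemigroup_mem (K := compactOperator (RingHom.id ℂ) H H)
      isClosed_setOfPred_isCompactOperator
      (fun z hz => by
        rw [sq]
        exact (hRc 1 (hhalf 1 hone) z hz).comp_clm (R 1 z)) one_pos) hu hp
    (by
      have h1 := eventually_exp_le_of_lt_growthRate (T := family T₀ T₁ 1) (x := u)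
        (a := 7 / 8 * p) (by positivity) (by
          rw [hgr]; exact_mod_cast (by linarith : 7 / 8 * p < p))
      filter_upwards [tendsto_natCast_atTop_atTop.eventually h1] with n hn
      rwa [hexp 1 hone n n.cast_nonneg] at hn)
  refine ⟨κ₀, hκ₀, η₀, hη₀, C, hC, τ, hτ, fun κ hκ => hgen κ (hκ.trans hκρ),
    fun x₀ p' hx₀ hxu hp0 hgr' κ x hκ hx t ht => ?_⟩
  have hpp : p' = p := by
    have : growthRate (family T₀ T₁ 1) u = (p' : EReal) := by
      rw [← hxu, growthRate_smul _ (by simpa using hx₀), hgr']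
    rw [hgr] at this
    exact_mod_cast this.symm
  subst hpp
  have hn : 0 < ‖x₀‖ := norm_pos_iff.2 hx₀
  have hc : ‖((‖x₀‖⁻¹ : ℝ) : ℂ)‖ = ‖x₀‖⁻¹ := by simp
  -- The estimate is homogeneous, so dividing by $\|x_0\|$ reduces it to the unit vector $u$.
  have h1 := hmain κ (((‖x₀‖⁻¹ : ℝ) : ℂ) • x) hκ (by
    rw [← hxu, ← smul_sub, norm_smul, hc, ← div_eq_inv_mul, div_le_iff₀ hn]
    exact hx) t ht
  rw [map_smul, norm_smul, norm_smul, hc, mul_left_comm] at h1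
  rw [hexp κ (hκ.trans hκρ) t (hτ.le.trans ht)]
  exact le_of_mul_le_mul_left h1 (inv_pos.2 hn)
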